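/- Double categories are pseudo double categories: arrows and cells compose strictly in the internal direction, while the external composition of proarrows (and of cells along arrows) is associative and unital up to coherent invertible globular cells; $x \odot y$ denotes external composition in diagrammatic order and $\mathrm{id}_x$ the external identity. Double functors are pseudo double functors. A \emph{companion} of an arrow $f: x \to y$ is a proarrow $f_!: x \nrightarrow y$ with cells $\eta: \mathrm{id}_x \to f_!$ (left side $1_x$, right side $f$) and $\varepsilon: f_! \to \mathrm{id}_y$ (left side $f$, right side $1_y$) whose internal composite is $\mathrm{id}_f$ and whose external composite is, up to unitors, the identity cell of $f_!$. A cell $\alpha: m \to n$ with left side $f$ and right side $g$ is a \emph{commuter} if $f$ and $g$ have companions and the globular cell $m \odot g_! \to f_! \odot n$ obtained from $\alpha$ by pasting with the unit of $f_!$ and the counit of $g_!$ is invertible (this does not depend on the choice of companions). Let $\mathbb{D}$ and $\mathbb{E}$ be double categories. Let $F, G: \mathbb{D} \to \mathbb{E}$ be lax double functors. A natural transformation $\alpha: F \Rightarrow G$ has component arrows $\alpha_x: Fx \to Gx$ and component cells $\alpha_m: Fm \to Gm$ with sides $\alpha_x, \alpha_y$ for $m: x \nrightarrow y$, strictly natural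 in arrows and cells and compatible with the lax comparison cells. An \emph{oplax protransformation} $\tau: F \nrightarrow G$ has component proarrows $\tau_x: Fx \nrightarrow Gx$, component cells $\tau_f: \tau_x \to \tau_y$ with sides $Ff, Gf$ for arrows $f: x \to y$, and globular comparison cells $\tau_m: Fm \odot \tau_y \to \tau_x \odot Gm$ for proarrows $m: x \nrightarrow y$, such that $\tau_f$ is functorial in $f$, $\tau_m$ is natural with respect to the cells of $\mathbb{D}$, and $\tau_m$ is coherent with external composites and identities; it is \emph{pseudo} if every $\tau_m$ is invertible. A \emph{modification} $\mu: \sigma \to \tau$ with left side $\alpha: F \Rightarrow H$ and right side $\beta: G \Rightarrow K$, between protransformations $\sigma: F \nrightarrow G$ and $\tau: H \nrightarrow K$, consists of cells $\mu_x: \sigma_x \to \tau_x$ with sides $\alpha_x, \beta_x$ that commute with the component cells $\sigma_f, \tau_f$ and with the comparison cells $\sigma_m, \tau_m$. Let $\mathbf{LaxOpl}(\mathbb{D},\mathbb{E})$ (respectively $\mathbf{LaxPs}(\mathbb{D},\mathbb{E})$) be the double category of lax double functors $\mathbb{D} \to \mathbb{E}$, natural transformations, oplax (respectively pseudo) protransformations,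 and modifications. Let $\mathbf{LaxComp}(\mathbb{D},\mathbb{E})$ be the strict double category whose objects are lax double functors $\mathbb{D} \to \mathbb{E}$, whose arrows are natural transformations all of whose component arrows have companions, whose proarrows are arbitrary natural transformations, and whose cells with top $\gamma: F \Rightarrow G$, bottom $\delta: H \Rightarrow K$, left side $\alpha: F \Rightarrow H$ and right side $\beta: G \Rightarrow K$ are the modifications $\beta \circ \gamma \Rrightarrow \delta \circ \alpha$, that is, modifications from the identity protransformation of $F$ to that of $K$ with left side $\beta \circ \gamma$ and right side $\delta \circ \alpha$. Let $\mathbf{LaxCC}(\mathbb{D},\mathbb{E})$ be defined in the same way, except that the arrows are the natural transformations whose component arrows have companions and whose component cells are commuters. For a strict double category $\mathbb{X}$, the transpose $\mathbb{X}^\top$ is obtained by interchanging arrows and proarrows. \textbf{Theorem.} For any double categories $\mathbb{D}$ and $\mathbb{E}$, there are double functors $$\mathbf{LaxComp}(\mathbb{D},\mathbb{E})^\top \to \mathbf{LaxOpl}(\mathbb{D},\mathbb{E}) \qquad\text{and}\qquad \mathbf{LaxCC}(\mathbb{D},\mathbb{E})^\top \to \mathbf{LaxPs}(\mathbb{D},\mathbb{E})$$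 that act as identities on objects (lax double functors) and arrows (natural transformations), and that send each proarrow, that is, each natural transformation $\alpha$ whose component arrows have companions (respectively, and whose component cells are commuters), to an oplax (respectively pseudo) protransformation that is a companion of $\alpha$ in $\mathbf{LaxOpl}(\mathbb{D},\mathbb{E})$ (respectively in $\mathbf{LaxPs}(\mathbb{D},\mathbb{E})$). -/

import Mathlib

open CategoryTheory

universe u v w t u₁ v₁ w₁ t₁ u₂ v₂ w₂ t₂

/-- The objects of the category of proarrows and cells: a proarrow with its endpoints. -/
structure ProObj {Obj : Type u} (Pro : Obj → Obj → Type w) where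
  {src : Obj}
  {tgt : Obj}
  pro : Pro src tgt

/-- A (pseudo) double category: a pseudocategory internal to categories. The objects and arrows form
the category `Obj`; the proarrows and cells form a category, whose composition is the (strict)
internal composition of cells. A cell `α : ⟨m⟩ ⟶ ⟨n⟩` has top `m`, bottom `n`, and boundary arrows
`left α`, `right α`. External composition of proarrows and of cells is written in diagrammatic
order. -/
structure DoubleCategory where
  Obj : Type u
  [cat : Category.{v} Obj]
  Pro : Obj → Obj → Type w
  [sqCat : Category.{t} (ProObj Pro)]
  left {m n : ProObj Pro} : (m ⟶ n) → (m.src ⟶ n.src)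
  right {m n : ProObj Pro} : (m ⟶ n) → (m.tgt ⟶ n.tgt)
  left_one (m : ProObj Pro) : left (𝟙 m) = 𝟙 m.src
  right_one (m : ProObj Pro) : right (𝟙 m) = 𝟙 m.tgt
  left_comp {m n p : ProObj Pro} (α : m ⟶ n) (β : n ⟶ p) : left (α ≫ β) = left α ≫ left β
  right_comp {m n p : ProObj Pro} (α : m ⟶ n) (β : n ⟶ p) : right (α ≫ β) = right α ≫ right β
  /-- the external identity proarrow -/
  hid (x : Obj) : Pro x x
  /-- the external identity cell on an arrow -/
  hidSq {x y : Obj} (f : x ⟶ y) : ProObj.mk (hid x) ⟶ ProObj.mk (hid y)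
  left_hidSq {x y : Obj} (f : x ⟶ y) : left (hidSq f) = f
  right_hidSq {x y : Obj} (f : x ⟶ y) : right (hidSq f) = f
  hidSq_id (x : Obj) : hidSq (𝟙 x) = 𝟙 (ProObj.mk (hid x))
  hidSq_comp {x y z : Obj} (f : x ⟶ y) (g : y ⟶ z) : hidSq (f ≫ g) = hidSq f ≫ hidSq g
  /-- external composition of proarrows -/
  hcomp {x y z : Obj} (m : Pro x y) (n : Pro y z) : Pro x z
  /-- external composition of cells -/
  hsq {x y z x' y' z' : Obj} {m : Pro x y} {n : Pro y z} {m' : Pro x' y'} {n' : Pro y' z'}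
    (α : ProObj.mk m ⟶ ProObj.mk m') (β : ProObj.mk n ⟶ ProObj.mk n') (h : right α = left β) :
    ProObj.mk (hcomp m n) ⟶ ProObj.mk (hcomp m' n')
  left_hsq {x y z x' y' z' : Obj} {m : Pro x y} {n : Pro y z} {m' : Pro x' y'} {n' : Pro y' z'}
    (α : ProObj.mk m ⟶ ProObj.mk m') (β : ProObj.mk n ⟶ ProObj.mk n') (h : right α = left β) :
    left (hsq α β h) = left α
  right_hsq {x y z x' y' z' : Obj} {m : Pro x y} {n : Pro y z} {m' : Pro x' y'} {n' : Pro y' z'}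
    (α : ProObj.mk m ⟶ ProObj.mk m') (β : ProObj.mk n ⟶ ProObj.mk n') (h : right α = left β) :
    right (hsq α β h) = right β
  hsq_one {x y z : Obj} (m : Pro x y) (n : Pro y z) :
    hsq (𝟙 (ProObj.mk m)) (𝟙 (ProObj.mk n)) ((right_one (ProObj.mk m)).trans (left_one (ProObj.mk n)).symm) =
      𝟙 (ProObj.mk (hcomp m n))
  /-- interchange -/
  hsq_comp {x y z x' y' z' x'' y'' z'' : Obj} {m : Pro x y} {n : Pro y z} {m' : Pro x' y'}
    {n' : Pro y' z'} {m'' : Pro x'' y''} {n'' : Pro y'' z''}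
    (α : ProObj.mk m ⟶ ProObj.mk m') (β : ProObj.mk n ⟶ ProObj.mk n') (h : right α = left β)
    (α' : ProObj.mk m' ⟶ ProObj.mk m'') (β' : ProObj.mk n' ⟶ ProObj.mk n'')
    (h' : right α' = left β') :
    hsq (α ≫ α') (β ≫ β')
      ((right_comp _ _).trans ((congrArg₂ (· ≫ ·) h h').trans (left_comp _ _).symm)) =
      hsq α β h ≫ hsq α' β' h'
  /-- associators -/
  assoc {x y z a : Obj} (m : Pro x y) (n : Pro y z) (p : Pro z a) :
    ProObj.mk (hcomp (hcomp m n) p) ≅ ProObj.mk (hcomp m (hcomp n p))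
  left_assoc {x y z a : Obj} (m : Pro x y) (n : Pro y z) (p : Pro z a) :
    left (assoc m n p).hom = 𝟙 x
  right_assoc {x y z a : Obj} (m : Pro x y) (n : Pro y z) (p : Pro z a) :
    right (assoc m n p).hom = 𝟙 a
  assoc_naturality {x y z a x' y' z' a' : Obj} {m : Pro x y} {n : Pro y z} {p : Pro z a}
    {m' : Pro x' y'} {n' : Pro y' z'} {p' : Pro z' a'}
    (α : ProObj.mk m ⟶ ProObj.mk m') (β : ProObj.mk n ⟶ ProObj.mk n')
    (γ : ProObj.mk p ⟶ ProObj.mk p') (h : right α = left β) (h' : right β = left γ) :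
    hsq (hsq α β h) γ ((right_hsq _ _ _).trans h') ≫ (assoc m' n' p').hom =
      (assoc m n p).hom ≫ hsq α (hsq β γ h') (h.trans (left_hsq _ _ _).symm)
  /-- unitors -/
  lunit {x y : Obj} (m : Pro x y) : ProObj.mk (hcomp (hid x) m) ≅ ProObj.mk m
  left_lunit {x y : Obj} (m : Pro x y) : left (lunit m).hom = 𝟙 x
  right_lunit {x y : Obj} (m : Pro x y) : right (lunit m).hom = 𝟙 y
  lunit_naturality {x y x' y' : Obj} {m : Pro x y} {m' : Pro x' y'}
    (α : ProObj.mk m ⟶ ProObj.mk m') :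
    hsq (hidSq (left α)) α (right_hidSq _) ≫ (lunit m').hom = (lunit m).hom ≫ α
  runit {x y : Obj} (m : Pro x y) : ProObj.mk (hcomp m (hid y)) ≅ ProObj.mk m
  left_runit {x y : Obj} (m : Pro x y) : left (runit m).hom = 𝟙 x
  right_runit {x y : Obj} (m : Pro x y) : right (runit m).hom = 𝟙 y
  runit_naturality {x y x' y' : Obj} {m : Pro x y} {m' : Pro x' y'}
    (α : ProObj.mk m ⟶ ProObj.mk m') :
    hsq α (hidSq (right α)) (left_hidSq _).symm ≫ (runit m').hom = (runit m).hom ≫ α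
  pentagon {x y z a b : Obj} (m : Pro x y) (n : Pro y z) (p : Pro z a) (q : Pro a b) :
    hsq (assoc m n p).hom (𝟙 (ProObj.mk q)) ((right_assoc _ _ _).trans (left_one (ProObj.mk q)).symm) ≫
        (assoc m (hcomp n p) q).hom ≫
        hsq (𝟙 (ProObj.mk m)) (assoc n p q).hom ((right_one (ProObj.mk m)).trans (left_assoc _ _ _).symm) =
      (assoc (hcomp m n) p q).hom ≫ (assoc m n (hcomp p q)).hom
  triangle {x y z : Obj} (m : Pro x y) (n : Pro y z) :
    (assoc m (hid y) n).hom ≫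
        hsq (𝟙 (ProObj.mk m)) (lunit n).hom ((right_one (ProObj.mk m)).trans (left_lunit _).symm) =
      hsq (runit m).hom (𝟙 (ProObj.mk n)) ((right_runit _).trans (left_one (ProObj.mk n)).symm)

namespace DoubleCategory

attribute [instance] cat sqCat
attribute [simp] left_one right_one left_comp right_comp left_hidSq right_hidSq left_hsq right_hsq
  left_assoc right_assoc left_lunit right_lunit left_runit right_runit hidSq_id hsq_one

/-- Cells with top `m` and bottom `n`. -/
abbrev Sq (X : DoubleCategory.{u, v, w, t}) {x y x' y' : X.Obj} (m : X.Pro x y) (n : X.Pro x' y') :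
    Type t :=
  ProObj.mk m ⟶ ProObj.mk n

variable (X : DoubleCategory.{u, v, w, t})

/-- The internal identity cell on a proarrow. -/
abbrev one {x y : X.Obj} (m : X.Pro x y) : X.Sq m m := 𝟙 (ProObj.mk m)

variable {X}

section lemmas

variable {x y z a b x' y' z' : X.Obj}

lemma left_inv {m n : ProObj X.Pro} (e : m ≅ n) :
    X.left e.inv ≫ X.left e.hom = 𝟙 _ := by
  rw [← left_comp, e.inv_hom_id, left_one]

lemma right_inv {m n : ProObj X.Pro} (e : m ≅ n) :
    X.right e.inv ≫ X.right e.hom = 𝟙 _ := by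
  rw [← right_comp, e.inv_hom_id, right_one]

@[simp] lemma left_assoc_inv (m : X.Pro x y) (n : X.Pro y z) (p : X.Pro z a) :
    X.left (X.assoc m n p).inv = 𝟙 x := by
  simpa using left_inv (X.assoc m n p)

@[simp] lemma right_assoc_inv (m : X.Pro x y) (n : X.Pro y z) (p : X.Pro z a) :
    X.right (X.assoc m n p).inv = 𝟙 a := by
  simpa using right_inv (X.assoc m n p)

@[simp] lemma left_lunit_inv (m : X.Pro x y) : X.left (X.lunit m).inv = 𝟙 x := by
  simpa using left_inv (X.lunit m)

@[simp] lemma right_lunit_inv (m : X.Pro x y) : X.right (X.lunit m).inv = 𝟙 y := by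
  simpa using right_inv (X.lunit m)

@[simp] lemma left_runit_inv (m : X.Pro x y) : X.left (X.runit m).inv = 𝟙 x := by
  simpa using left_inv (X.runit m)

@[simp] lemma right_runit_inv (m : X.Pro x y) : X.right (X.runit m).inv = 𝟙 y := by
  simpa using right_inv (X.runit m)

lemma left_isIso_inv {m n : ProObj X.Pro} (α : m ⟶ n) [IsIso α] :
    X.left (inv α) ≫ X.left α = 𝟙 _ := left_inv (asIso α)

lemma right_isIso_inv {m n : ProObj X.Pro} (α : m ⟶ n) [IsIso α] :
    X.right (inv α) ≫ X.right α = 𝟙 _ := right_inv (asIso α)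

lemma hsq_hsq {x y z x' y' z' x'' y'' z'' : X.Obj} {m : X.Pro x y} {n : X.Pro y z}
    {m' : X.Pro x' y'} {n' : X.Pro y' z'} {m'' : X.Pro x'' y''} {n'' : X.Pro y'' z''}
    (α : X.Sq m m') (β : X.Sq n n') (h) (α' : X.Sq m' m'') (β' : X.Sq n' n'') (h') :
    X.hsq α β h ≫ X.hsq α' β' h' =
      X.hsq (α ≫ α') (β ≫ β') (by simp only [left_comp, right_comp, h, h']) :=
  (X.hsq_comp α β h α' β' h').symm

lemma hsq_congr {m : X.Pro x y} {n : X.Pro y z} {m' : X.Pro x' y'} {n' : X.Pro y' z'}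
    {α α' : X.Sq m m'} {β β' : X.Sq n n'} (h : X.right α = X.left β) (e : α = α') (e' : β = β') :
    X.hsq α β h = X.hsq α' β' (by rw [← e, ← e', h]) := by
  subst e e'; rfl

lemma hsq_eq_one {m : X.Pro x y} {n : X.Pro y z} {α : X.Sq m m} {β : X.Sq n n}
    (h : X.right α = X.left β) (e : α = 𝟙 _) (e' : β = 𝟙 _) : X.hsq α β h = 𝟙 _ := by
  subst e e'; exact X.hsq_one _ _

lemma assoc_inv_naturality {x y z a x' y' z' a' : X.Obj} {m : X.Pro x y} {n : X.Pro y z}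
    {p : X.Pro z a} {m' : X.Pro x' y'} {n' : X.Pro y' z'} {p' : X.Pro z' a'}
    (α : X.Sq m m') (β : X.Sq n n') (γ : X.Sq p p') (h : X.right α = X.left β)
    (h' : X.right β = X.left γ) :
    X.hsq α (X.hsq β γ h') (h.trans (X.left_hsq _ _ _).symm) ≫ (X.assoc m' n' p').inv =
      (X.assoc m n p).inv ≫ X.hsq (X.hsq α β h) γ ((X.right_hsq _ _ _).trans h') := by
  rw [Iso.comp_inv_eq, Category.assoc, Iso.eq_inv_comp, assoc_naturality]

lemma lunit_inv_naturality {m : X.Pro x y} {m' : X.Pro x' y'} (α : X.Sq m m') :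
    α ≫ (X.lunit m').inv = (X.lunit m).inv ≫ X.hsq (X.hidSq (X.left α)) α (X.right_hidSq _) := by
  rw [Iso.comp_inv_eq, Category.assoc, Iso.eq_inv_comp, lunit_naturality]

lemma runit_inv_naturality {m : X.Pro x y} {m' : X.Pro x' y'} (α : X.Sq m m') :
    α ≫ (X.runit m').inv =
      (X.runit m).inv ≫ X.hsq α (X.hidSq (X.right α)) (X.left_hidSq _).symm := by
  rw [Iso.comp_inv_eq, Category.assoc, Iso.eq_inv_comp, runit_naturality]

lemma lunit_naturality' {m : X.Pro x y} {m' : X.Pro x' y'} (α : X.Sq m m') {f : x ⟶ x'}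
    (hf : X.left α = f) :
    X.hsq (X.hidSq f) α (by simp [hf]) ≫ (X.lunit m').hom = (X.lunit m).hom ≫ α := by
  subst hf; exact X.lunit_naturality α

lemma runit_naturality' {m : X.Pro x y} {m' : X.Pro x' y'} (α : X.Sq m m') {f : y ⟶ y'}
    (hf : X.right α = f) :
    X.hsq α (X.hidSq f) (by simp [hf]) ≫ (X.runit m').hom = (X.runit m).hom ≫ α := by
  subst hf; exact X.runit_naturality α

section reassociated

variable {q : ProObj X.Pro}

lemma hsq_hsq_assoc {x y z x' y' z' x'' y'' z'' : X.Obj} {m : X.Pro x y} {n : X.Pro y z}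
    {m' : X.Pro x' y'} {n' : X.Pro y' z'} {m'' : X.Pro x'' y''} {n'' : X.Pro y'' z''}
    (α : X.Sq m m') (β : X.Sq n n') (h) (α' : X.Sq m' m'') (β' : X.Sq n' n'') (h')
    (k : ProObj.mk (X.hcomp m'' n'') ⟶ q) :
    X.hsq α β h ≫ X.hsq α' β' h' ≫ k =
      X.hsq (α ≫ α') (β ≫ β') (by simp only [left_comp, right_comp, h, h']) ≫ k := by
  rw [← Category.assoc, hsq_hsq]

lemma assoc_naturality_assoc {x y z a x' y' z' a' : X.Obj} {m : X.Pro x y} {n : X.Pro y z}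
    {p : X.Pro z a} {m' : X.Pro x' y'} {n' : X.Pro y' z'} {p' : X.Pro z' a'}
    (α : X.Sq m m') (β : X.Sq n n') (γ : X.Sq p p') (h : X.right α = X.left β)
    (h' : X.right β = X.left γ) (k : ProObj.mk (X.hcomp m' (X.hcomp n' p')) ⟶ q) :
    X.hsq (X.hsq α β h) γ ((X.right_hsq _ _ _).trans h') ≫ (X.assoc m' n' p').hom ≫ k =
      (X.assoc m n p).hom ≫ X.hsq α (X.hsq β γ h') (h.trans (X.left_hsq _ _ _).symm) ≫ k := by
  rw [← Category.assoc, assoc_naturality, Category.assoc]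

lemma assoc_inv_naturality_assoc {x y z a x' y' z' a' : X.Obj} {m : X.Pro x y} {n : X.Pro y z}
    {p : X.Pro z a} {m' : X.Pro x' y'} {n' : X.Pro y' z'} {p' : X.Pro z' a'}
    (α : X.Sq m m') (β : X.Sq n n') (γ : X.Sq p p') (h : X.right α = X.left β)
    (h' : X.right β = X.left γ) (k : ProObj.mk (X.hcomp (X.hcomp m' n') p') ⟶ q) :
    X.hsq α (X.hsq β γ h') (h.trans (X.left_hsq _ _ _).symm) ≫ (X.assoc m' n' p').inv ≫ k =
      (X.assoc m n p).inv ≫ X.hsq (X.hsq α β h) γ ((X.right_hsq _ _ _).trans h') ≫ k := by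
  rw [← Category.assoc, assoc_inv_naturality, Category.assoc]

lemma lunit_inv_naturality_assoc {m : X.Pro x y} {m' : X.Pro x' y'} (α : X.Sq m m')
    (k : ProObj.mk (X.hcomp (X.hid x') m') ⟶ q) :
    α ≫ (X.lunit m').inv ≫ k =
      (X.lunit m).inv ≫ X.hsq (X.hidSq (X.left α)) α (X.right_hidSq _) ≫ k := by
  rw [← Category.assoc, lunit_inv_naturality, Category.assoc]

lemma runit_inv_naturality_assoc {m : X.Pro x y} {m' : X.Pro x' y'} (α : X.Sq m m')
    (k : ProObj.mk (X.hcomp m' (X.hid y')) ⟶ q) :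
    α ≫ (X.runit m').inv ≫ k =
      (X.runit m).inv ≫ X.hsq α (X.hidSq (X.right α)) (X.left_hidSq _).symm ≫ k := by
  rw [← Category.assoc, runit_inv_naturality, Category.assoc]

lemma lunit_naturality'_assoc {m : X.Pro x y} {m' : X.Pro x' y'} (α : X.Sq m m') {f : x ⟶ x'}
    (hf : X.left α = f) (k : ProObj.mk m' ⟶ q) :
    X.hsq (X.hidSq f) α (by simp [hf]) ≫ (X.lunit m').hom ≫ k = (X.lunit m).hom ≫ α ≫ k := by
  rw [← Category.assoc, lunit_naturality' α hf, Category.assoc]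

lemma runit_naturality'_assoc {m : X.Pro x y} {m' : X.Pro x' y'} (α : X.Sq m m') {f : y ⟶ y'}
    (hf : X.right α = f) (k : ProObj.mk m' ⟶ q) :
    X.hsq α (X.hidSq f) (by simp [hf]) ≫ (X.runit m').hom ≫ k = (X.runit m).hom ≫ α ≫ k := by
  rw [← Category.assoc, runit_naturality' α hf, Category.assoc]

end reassociated

end lemmas

/-- The objects of `X`, viewed as the objects of the underlying bicategory of `X`. -/
structure Hor (X : DoubleCategory.{u, v, w, t}) where
  of : X.Obj

/-- Globular cells. -/
structure Glob {x y : X.Obj} (m n : X.Pro x y) where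
  sq : X.Sq m n
  left : X.left sq = 𝟙 x
  right : X.right sq = 𝟙 y

attribute [simp] Glob.left Glob.right

lemma Glob.ext {x y : X.Obj} {m n : X.Pro x y} {α β : Glob m n} (h : α.sq = β.sq) : α = β := by
  cases α; cases β; cases h; rfl

instance (x y : X.Obj) : Category (X.Pro x y) where
  Hom m n := Glob m n
  id m := ⟨𝟙 _, by simp, by simp⟩
  comp α β := ⟨α.sq ≫ β.sq, by simp, by simp⟩
  id_comp α := Glob.ext (Category.id_comp _)
  comp_id α := Glob.ext (Category.comp_id _)
  assoc α β γ := Glob.ext (Category.assoc _ _ _)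

/-- The underlying bicategory: objects, proarrows and globular cells. -/
instance : Bicategory (Hor X) where
  Hom x y := X.Pro x.of y.of
  id x := X.hid x.of
  comp m n := X.hcomp m n
  homCategory x y := inferInstanceAs (Category (X.Pro x.of y.of))
  whiskerLeft m _ _ α := ⟨X.hsq (X.one m) α.sq (by simp), by simp, by simp⟩
  whiskerRight α n := ⟨X.hsq α.sq (X.one n) (by simp), by simp, by simp⟩
  associator m n p :=
    { hom := ⟨(X.assoc m n p).hom, by simp, by simp⟩
      inv := ⟨(X.assoc m n p).inv, by simp, by simp⟩
      hom_inv_id := Glob.ext (X.assoc m n p).hom_inv_id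
      inv_hom_id := Glob.ext (X.assoc m n p).inv_hom_id }
  leftUnitor m :=
    { hom := ⟨(X.lunit m).hom, by simp, by simp⟩
      inv := ⟨(X.lunit m).inv, by simp, by simp⟩
      hom_inv_id := Glob.ext (X.lunit m).hom_inv_id
      inv_hom_id := Glob.ext (X.lunit m).inv_hom_id }
  rightUnitor m :=
    { hom := ⟨(X.runit m).hom, by simp, by simp⟩
      inv := ⟨(X.runit m).inv, by simp, by simp⟩
      hom_inv_id := Glob.ext (X.runit m).hom_inv_id
      inv_hom_id := Glob.ext (X.runit m).inv_hom_id }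
  whiskerLeft_id m n := Glob.ext (X.hsq_one m n)
  whiskerLeft_comp m _ _ _ α β := Glob.ext <| by
    change X.hsq _ (α.sq ≫ β.sq) _ = X.hsq _ _ _ ≫ X.hsq _ _ _
    rw [hsq_hsq]; exact hsq_congr _ (by simp) rfl
  id_whiskerLeft α := Glob.ext <| by
    change X.hsq _ α.sq _ = (X.lunit _).hom ≫ α.sq ≫ (X.lunit _).inv
    rw [← lunit_naturality'_assoc α.sq α.left, Iso.hom_inv_id, Category.comp_id]
    exact hsq_congr _ (by simp) rfl
  comp_whiskerLeft m n _ _ α := Glob.ext <| by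
    change X.hsq (X.one _) α.sq _ = (X.assoc _ _ _).hom ≫ X.hsq _ (X.hsq _ _ _) _ ≫ (X.assoc _ _ _).inv
    rw [← Iso.inv_comp_eq, assoc_inv_naturality _ _ _ (by simp)]
    congr 1
    exact hsq_congr _ (by simp) rfl
  id_whiskerRight m n := Glob.ext (X.hsq_one m n)
  comp_whiskerRight α β n := Glob.ext <| by
    change X.hsq (α.sq ≫ β.sq) _ _ = X.hsq _ _ _ ≫ X.hsq _ _ _
    rw [hsq_hsq]; exact hsq_congr _ rfl (by simp)
  whiskerRight_id α := Glob.ext <| by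
    change X.hsq α.sq _ _ = (X.runit _).hom ≫ α.sq ≫ (X.runit _).inv
    rw [← runit_naturality'_assoc α.sq α.right, Iso.hom_inv_id, Category.comp_id]
    exact hsq_congr _ rfl (by simp)
  whiskerRight_comp α n p := Glob.ext <| by
    change X.hsq α.sq (X.one _) _ = (X.assoc _ _ _).inv ≫ X.hsq (X.hsq _ _ _) _ _ ≫ (X.assoc _ _ _).hom
    rw [Iso.eq_inv_comp, X.assoc_naturality α.sq (X.one n) (X.one p) (by simp) (by simp)]
    congr 1
    exact hsq_congr _ rfl (by simp)
  whisker_assoc m _ _ α p := Glob.ext <| by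
    change X.hsq (X.hsq _ α.sq _) _ _ = (X.assoc _ _ _).hom ≫ X.hsq _ (X.hsq _ _ _) _ ≫ (X.assoc _ _ _).inv
    rw [← Category.assoc, ← assoc_naturality, Category.assoc, Iso.hom_inv_id, Category.comp_id]
  whisker_exchange α β := Glob.ext <| by
    change X.hsq _ _ _ ≫ X.hsq _ _ _ = X.hsq _ _ _ ≫ X.hsq _ _ _
    rw [hsq_hsq, hsq_hsq]; exact hsq_congr _ (by simp) (by simp)
  pentagon m n p q := Glob.ext (X.pentagon m n p q)
  triangle m n := Glob.ext (X.triangle m n)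

end DoubleCategory

namespace DoubleCategory

/-- A lax double functor: a functor on objects and arrows, a functor on proarrows and cells
compatible with the boundaries, and coherent globular comparison cells. -/
structure LaxDoubleFunctor (D : DoubleCategory.{u₁, v₁, w₁, t₁})
    (E : DoubleCategory.{u₂, v₂, w₂, t₂}) extends D.Obj ⥤ E.Obj where
  pro {x y : D.Obj} : D.Pro x y → E.Pro (obj x) (obj y)
  sq {x y x' y' : D.Obj} {m : D.Pro x y} {n : D.Pro x' y'} : D.Sq m n → E.Sq (pro m) (pro n)
  left_sq {x y x' y' : D.Obj} {m : D.Pro x y} {n : D.Pro x' y'} (α : D.Sq m n) :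
    E.left (sq α) = map (D.left α)
  right_sq {x y x' y' : D.Obj} {m : D.Pro x y} {n : D.Pro x' y'} (α : D.Sq m n) :
    E.right (sq α) = map (D.right α)
  sq_one {x y : D.Obj} (m : D.Pro x y) : sq (D.one m) = E.one (pro m)
  sq_comp {x y x' y' x'' y'' : D.Obj} {m : D.Pro x y} {n : D.Pro x' y'} {p : D.Pro x'' y''}
    (α : D.Sq m n) (β : D.Sq n p) : sq (α ≫ β) = sq α ≫ sq β
  /-- the comparison for external composition -/
  lax {x y z : D.Obj} (m : D.Pro x y) (n : D.Pro y z) :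
    E.Sq (E.hcomp (pro m) (pro n)) (pro (D.hcomp m n))
  left_lax {x y z : D.Obj} (m : D.Pro x y) (n : D.Pro y z) : E.left (lax m n) = 𝟙 (obj x)
  right_lax {x y z : D.Obj} (m : D.Pro x y) (n : D.Pro y z) : E.right (lax m n) = 𝟙 (obj z)
  /-- the comparison for external identities -/
  unit (x : D.Obj) : E.Sq (E.hid (obj x)) (pro (D.hid x))
  left_unit (x : D.Obj) : E.left (unit x) = 𝟙 (obj x)
  right_unit (x : D.Obj) : E.right (unit x) = 𝟙 (obj x)
  lax_naturality {x y z x' y' z' : D.Obj} {m : D.Pro x y} {n : D.Pro y z} {m' : D.Pro x' y'}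
    {n' : D.Pro y' z'} (α : D.Sq m m') (β : D.Sq n n') (h : D.right α = D.left β) :
    E.hsq (sq α) (sq β) (by rw [right_sq, left_sq, h]) ≫ lax m' n' =
      lax m n ≫ sq (D.hsq α β h)
  unit_naturality {x y : D.Obj} (f : x ⟶ y) :
    E.hidSq (map f) ≫ unit y = unit x ≫ sq (D.hidSq f)
  lax_assoc {x y z a : D.Obj} (m : D.Pro x y) (n : D.Pro y z) (p : D.Pro z a) :
    E.hsq (lax m n) (E.one (pro p)) (by simp [right_lax]) ≫ lax (D.hcomp m n) p ≫
        sq (D.assoc m n p).hom =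
      (E.assoc (pro m) (pro n) (pro p)).hom ≫
        E.hsq (E.one (pro m)) (lax n p) (by simp [left_lax]) ≫ lax m (D.hcomp n p)
  lax_lunit {x y : D.Obj} (m : D.Pro x y) :
    E.hsq (unit x) (E.one (pro m)) (by simp [right_unit]) ≫ lax (D.hid x) m ≫
      sq (D.lunit m).hom = (E.lunit (pro m)).hom
  lax_runit {x y : D.Obj} (m : D.Pro x y) :
    E.hsq (E.one (pro m)) (unit y) (by simp [left_unit]) ≫ lax m (D.hid y) ≫
      sq (D.runit m).hom = (E.runit (pro m)).hom

/-- A (pseudo) double functor: a lax one whose comparison cells are invertible. -/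
structure DoubleFunctor (D : DoubleCategory.{u₁, v₁, w₁, t₁})
    (E : DoubleCategory.{u₂, v₂, w₂, t₂}) extends LaxDoubleFunctor D E where
  isIso_lax {x y z : D.Obj} (m : D.Pro x y) (n : D.Pro y z) : IsIso (lax m n)
  isIso_unit (x : D.Obj) : IsIso (unit x)

variable {D : DoubleCategory.{u₁, v₁, w₁, t₁}} {E : DoubleCategory.{u₂, v₂, w₂, t₂}}

namespace LaxDoubleFunctor

attribute [simp] left_sq right_sq left_lax right_lax left_unit right_unit sq_one

/-- A (tight, strict) natural transformation between lax double functors. -/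
@[ext]
structure NatTrans (F G : LaxDoubleFunctor D E) where
  app (x : D.Obj) : F.obj x ⟶ G.obj x
  naturality {x y : D.Obj} (f : x ⟶ y) : F.map f ≫ app y = app x ≫ G.map f
  sq {x y : D.Obj} (m : D.Pro x y) : E.Sq (F.pro m) (G.pro m)
  left_sq {x y : D.Obj} (m : D.Pro x y) : E.left (sq m) = app x
  right_sq {x y : D.Obj} (m : D.Pro x y) : E.right (sq m) = app y
  sq_naturality {x y x' y' : D.Obj} {m : D.Pro x y} {n : D.Pro x' y'} (γ : D.Sq m n) :
    F.sq γ ≫ sq n = sq m ≫ G.sq γ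
  sq_hcomp {x y z : D.Obj} (m : D.Pro x y) (n : D.Pro y z) :
    F.lax m n ≫ sq (D.hcomp m n) =
      E.hsq (sq m) (sq n) ((right_sq m).trans (left_sq n).symm) ≫ G.lax m n
  sq_hid (x : D.Obj) : F.unit x ≫ sq (D.hid x) = E.hidSq (app x) ≫ G.unit x

attribute [simp] NatTrans.left_sq NatTrans.right_sq

instance : Category (LaxDoubleFunctor D E) where
  Hom := NatTrans
  id F :=
    { app x := 𝟙 (F.obj x)
      naturality f := by simp
      sq m := E.one (F.pro m)
      left_sq m := by simp
      right_sq m := by simp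
      sq_naturality γ := by simp
      sq_hcomp m n := by simp
      sq_hid x := by simp }
  comp {F G H} α β :=
    { app x := α.app x ≫ β.app x
      naturality f := by
        rw [← Category.assoc, α.naturality, Category.assoc, β.naturality, Category.assoc]
      sq m := α.sq m ≫ β.sq m
      left_sq m := by simp
      right_sq m := by simp
      sq_naturality γ := by
        rw [← Category.assoc, α.sq_naturality, Category.assoc, β.sq_naturality, Category.assoc]
      sq_hcomp m n := by
        rw [← Category.assoc, α.sq_hcomp, Category.assoc, β.sq_hcomp, ← Category.assoc, hsq_hsq]
      sq_hid x := by
        rw [← Category.assoc, α.sq_hid, Category.assoc, β.sq_hid, ← Category.assoc, hidSq_comp] }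
  id_comp α := NatTrans.ext (by funext; exact Category.id_comp _)
    (by funext x y m; exact Category.id_comp (α.sq m))
  comp_id α := NatTrans.ext (by funext; exact Category.comp_id _)
    (by funext x y m; exact Category.comp_id (α.sq m))
  assoc α β γ := NatTrans.ext (by funext; exact Category.assoc _ _ _)
    (by funext x y m; exact Category.assoc (α.sq m) (β.sq m) (γ.sq m))

@[simp] lemma id_app (F : LaxDoubleFunctor D E) (x : D.Obj) :
    NatTrans.app (𝟙 F) x = 𝟙 (F.obj x) := rfl

@[simp] lemma comp_app {F G H : LaxDoubleFunctor D E} (α : F ⟶ G) (β : G ⟶ H) (x : D.Obj) :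
    NatTrans.app (α ≫ β) x = NatTrans.app α x ≫ NatTrans.app β x := rfl

@[simp] lemma id_sq (F : LaxDoubleFunctor D E) {x y : D.Obj} (m : D.Pro x y) :
    NatTrans.sq (𝟙 F) m = E.one (F.pro m) := rfl

@[simp] lemma comp_sq {F G H : LaxDoubleFunctor D E} (α : F ⟶ G) (β : G ⟶ H) {x y : D.Obj}
    (m : D.Pro x y) : NatTrans.sq (α ≫ β) m = NatTrans.sq α m ≫ NatTrans.sq β m := rfl

/-- The lax functor between underlying bicategories. -/
def toHor (F : LaxDoubleFunctor D E) : LaxFunctor (Hor D) (Hor E) where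
  obj x := ⟨F.obj x.of⟩
  map m := F.pro m
  map₂ α := ⟨F.sq α.sq, by simp, by simp⟩
  mapId x := ⟨F.unit x.of, by simp, by simp⟩
  mapComp m n := ⟨F.lax m n, by simp, by simp⟩
  map₂_id m := Glob.ext (F.sq_one m)
  map₂_comp α β := Glob.ext (F.sq_comp α.sq β.sq)
  mapComp_naturality_left α m := Glob.ext <| by
    change F.lax _ _ ≫ F.sq (D.hsq _ _ _) = E.hsq _ _ _ ≫ F.lax _ _
    rw [← F.lax_naturality]; congr 1; exact hsq_congr _ rfl (by simp)
  mapComp_naturality_right m _ _ α := Glob.ext <| by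
    change F.lax _ _ ≫ F.sq (D.hsq _ _ _) = E.hsq _ _ _ ≫ F.lax _ _
    rw [← F.lax_naturality]; congr 1; exact hsq_congr _ (by simp) rfl
  map₂_associator m n p := Glob.ext (F.lax_assoc m n p)
  map₂_leftUnitor m := Glob.ext <| by
    change F.sq (D.lunit m).inv = (E.lunit (F.pro m)).inv ≫ E.hsq (F.unit _) _ _ ≫ F.lax _ _
    rw [Iso.eq_inv_comp, ← F.lax_lunit m, Category.assoc, Category.assoc, ← F.sq_comp,
      Iso.hom_inv_id, F.sq_one, Category.comp_id]
  map₂_rightUnitor m := Glob.ext <| by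
    change F.sq (D.runit m).inv = (E.runit (F.pro m)).inv ≫ E.hsq _ (F.unit _) _ ≫ F.lax _ _
    rw [Iso.eq_inv_comp, ← F.lax_runit m, Category.assoc, Category.assoc, ← F.sq_comp,
      Iso.hom_inv_id, F.sq_one, Category.comp_id]

end LaxDoubleFunctor

/-- An oplax protransformation between lax double functors. -/
structure OplaxProtrans (F G : LaxDoubleFunctor D E) where
  app (x : D.Obj) : E.Pro (F.obj x) (G.obj x)
  /-- the component at an arrow -/
  sq {x y : D.Obj} (f : x ⟶ y) : E.Sq (app x) (app y)
  left_sq {x y : D.Obj} (f : x ⟶ y) : E.left (sq f) = F.map f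
  right_sq {x y : D.Obj} (f : x ⟶ y) : E.right (sq f) = G.map f
  /-- the globular naturality comparison at a proarrow -/
  nat {x y : D.Obj} (m : D.Pro x y) :
    E.Sq (E.hcomp (F.pro m) (app y)) (E.hcomp (app x) (G.pro m))
  left_nat {x y : D.Obj} (m : D.Pro x y) : E.left (nat m) = 𝟙 (F.obj x)
  right_nat {x y : D.Obj} (m : D.Pro x y) : E.right (nat m) = 𝟙 (G.obj y)
  sq_id (x : D.Obj) : sq (𝟙 x) = E.one (app x)
  sq_comp {x y z : D.Obj} (f : x ⟶ y) (g : y ⟶ z) : sq (f ≫ g) = sq f ≫ sq g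
  naturality {x y x' y' : D.Obj} {m : D.Pro x y} {n : D.Pro x' y'} (γ : D.Sq m n) :
    E.hsq (F.sq γ) (sq (D.right γ)) ((F.right_sq γ).trans (left_sq _).symm) ≫ nat n =
      nat m ≫ E.hsq (sq (D.left γ)) (G.sq γ) ((right_sq _).trans (G.left_sq γ).symm)
  nat_hcomp {x y z : D.Obj} (m : D.Pro x y) (n : D.Pro y z) :
    E.hsq (F.lax m n) (E.one (app z)) (by simp) ≫ nat (D.hcomp m n) =
      (E.assoc (F.pro m) (F.pro n) (app z)).hom ≫
        E.hsq (E.one (F.pro m)) (nat n) (by simp [left_nat]) ≫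
        (E.assoc (F.pro m) (app y) (G.pro n)).inv ≫
        E.hsq (nat m) (E.one (G.pro n)) (by simp [right_nat]) ≫
        (E.assoc (app x) (G.pro m) (G.pro n)).hom ≫
        E.hsq (E.one (app x)) (G.lax m n) (by simp)
  nat_hid (x : D.Obj) :
    E.hsq (F.unit x) (E.one (app x)) (by simp) ≫ nat (D.hid x) =
      (E.lunit (app x)).hom ≫ (E.runit (app x)).inv ≫
        E.hsq (E.one (app x)) (G.unit x) (by simp)

namespace OplaxProtrans

attribute [simp] left_sq right_sq left_nat right_nat sq_id

/-- The oplax transformation between lax functors of underlying bicategories. -/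
def toHor {F G : LaxDoubleFunctor D E} (σ : OplaxProtrans F G) :
    Lax.OplaxTrans F.toHor G.toHor where
  app x := σ.app x.of
  naturality m := ⟨σ.nat m, σ.left_nat m, σ.right_nat m⟩
  naturality_naturality {x y m n} γ := Glob.ext <| by
    change E.hsq (F.sq γ.sq) (E.one _) _ ≫ σ.nat n = σ.nat m ≫ E.hsq (E.one _) (G.sq γ.sq) _
    have h := σ.naturality γ.sq
    have h₁ : σ.sq (D.right γ.sq) = E.one _ := by rw [γ.right, sq_id]
    have h₂ : σ.sq (D.left γ.sq) = E.one _ := by rw [γ.left, sq_id]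
    rw [hsq_congr _ rfl h₁, hsq_congr _ h₂ rfl] at h
    exact h
  naturality_id x := Glob.ext (σ.nat_hid x.of)
  naturality_comp m n := Glob.ext (σ.nat_hcomp m n)

/-- Pasting of two globular comparison squares. -/
def paste {x₀ x₁ x₂ y₀ y₁ y₂ : E.Obj} {a : E.Pro x₀ y₀} {b : E.Pro x₁ y₁} {c : E.Pro x₂ y₂}
    {p : E.Pro x₀ x₁} {q : E.Pro x₁ x₂} {p' : E.Pro y₀ y₁} {q' : E.Pro y₁ y₂}
    (s : E.Sq (E.hcomp a p') (E.hcomp p b)) (t : E.Sq (E.hcomp b q') (E.hcomp q c))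
    (hs : E.right s = 𝟙 _) (ht : E.left t = 𝟙 _) :
    E.Sq (E.hcomp a (E.hcomp p' q')) (E.hcomp (E.hcomp p q) c) :=
  (E.assoc a p' q').inv ≫ E.hsq s (E.one q') (by simp [hs]) ≫ (E.assoc p b q').hom ≫
    E.hsq (E.one p) t (by simp [ht]) ≫ (E.assoc p q c).inv

lemma paste_naturality {x₀ x₁ x₂ y₀ y₁ y₂ : E.Obj} {a : E.Pro x₀ y₀} {b : E.Pro x₁ y₁}
    {c : E.Pro x₂ y₂} {p : E.Pro x₀ x₁} {q : E.Pro x₁ x₂} {p' : E.Pro y₀ y₁} {q' : E.Pro y₁ y₂}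
    {s : E.Sq (E.hcomp a p') (E.hcomp p b)} {t : E.Sq (E.hcomp b q') (E.hcomp q c)}
    {hs : E.right s = 𝟙 _} {ht : E.left t = 𝟙 _}
    {X₀ X₁ X₂ Y₀ Y₁ Y₂ : E.Obj} {A : E.Pro X₀ Y₀} {B : E.Pro X₁ Y₁}
    {C : E.Pro X₂ Y₂} {P : E.Pro X₀ X₁} {Q : E.Pro X₁ X₂} {P' : E.Pro Y₀ Y₁} {Q' : E.Pro Y₁ Y₂}
    {S : E.Sq (E.hcomp A P') (E.hcomp P B)} {T : E.Sq (E.hcomp B Q') (E.hcomp Q C)}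
    {hS : E.right S = 𝟙 _} {hT : E.left T = 𝟙 _}
    (α : E.Sq a A) (β : E.Sq b B) (γ : E.Sq c C) (μ : E.Sq p P) (ν : E.Sq q Q)
    (μ' : E.Sq p' P') (ν' : E.Sq q' Q')
    (h₁ : E.right α = E.left μ') (h₂ : E.right μ = E.left β) (h₃ : E.right β = E.left ν')
    (h₄ : E.right ν = E.left γ) (h₅ : E.right μ' = E.left ν') (h₆ : E.right μ = E.left ν)
    (e₁ : E.hsq α μ' h₁ ≫ S = s ≫ E.hsq μ β h₂)
    (e₂ : E.hsq β ν' h₃ ≫ T = t ≫ E.hsq ν γ h₄) :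
    E.hsq α (E.hsq μ' ν' h₅) (by simp [h₁]) ≫ paste S T hS hT =
      paste s t hs ht ≫ E.hsq (E.hsq μ ν h₆) γ (by simp [h₄]) := by
  unfold paste
  simp only [Category.assoc]
  rw [assoc_inv_naturality_assoc _ _ _ h₁ h₅, hsq_hsq_assoc,
    hsq_congr _ e₁ ((Category.comp_id _).trans (Category.id_comp _).symm),
    ← hsq_hsq_assoc s (E.one _) (by simp [hs]) (E.hsq μ β h₂) ν' (by simp [h₃]),
    E.assoc_naturality_assoc _ _ _ h₂ h₃, hsq_hsq_assoc,
    hsq_congr _ ((Category.comp_id _).trans (Category.id_comp _).symm) e₂,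
    ← hsq_hsq_assoc (E.one _) t (by simp [ht]) μ (E.hsq ν γ h₄) (by simp [h₆]),
    assoc_inv_naturality _ _ _ h₆ h₄]

lemma idSq_naturality {x y x' y' : E.Obj} {m : E.Pro x y} {m' : E.Pro x' y'} (α : E.Sq m m')
    {f : x ⟶ x'} {g : y ⟶ y'} (hf : E.left α = f) (hg : E.right α = g) :
    E.hsq α (E.hidSq g) (by simp [hg]) ≫ (E.runit m').hom ≫ (E.lunit m').inv =
      ((E.runit m).hom ≫ (E.lunit m).inv) ≫ E.hsq (E.hidSq f) α (by simp [hf]) := by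
  subst hf hg
  rw [runit_naturality'_assoc α rfl, lunit_inv_naturality, Category.assoc]

/-- The identity protransformation. -/
def id (F : LaxDoubleFunctor D E) : OplaxProtrans F F where
  app x := E.hid (F.obj x)
  sq f := E.hidSq (F.map f)
  left_sq f := by simp
  right_sq f := by simp
  nat m := (E.runit (F.pro m)).hom ≫ (E.lunit (F.pro m)).inv
  left_nat m := by simp
  right_nat m := by simp
  sq_id x := by simp
  sq_comp f g := by simp [hidSq_comp]
  naturality γ := idSq_naturality (F.sq γ) (F.left_sq γ) (F.right_sq γ)
  nat_hcomp m n := congrArg Glob.sq ((Lax.OplaxTrans.id F.toHor).naturality_comp (a := ⟨_⟩)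
    (b := ⟨_⟩) (c := ⟨_⟩) m n)
  nat_hid x := congrArg Glob.sq ((Lax.OplaxTrans.id F.toHor).naturality_id ⟨x⟩)

/-- The composite of protransformations. -/
def comp {F G H : LaxDoubleFunctor D E} (σ : OplaxProtrans F G) (τ : OplaxProtrans G H) :
    OplaxProtrans F H where
  app x := E.hcomp (σ.app x) (τ.app x)
  sq f := E.hsq (σ.sq f) (τ.sq f) (by simp)
  left_sq f := by simp
  right_sq f := by simp
  nat m := paste (σ.nat m) (τ.nat m) (by simp) (by simp)
  left_nat m := by simp [paste]
  right_nat m := by simp [paste]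
  sq_id x := hsq_eq_one _ (σ.sq_id x) (τ.sq_id x)
  sq_comp f g := by rw [hsq_hsq]; exact hsq_congr _ (σ.sq_comp f g) (τ.sq_comp f g)
  naturality γ := paste_naturality _ _ _ _ _ _ _ _ _ _ _ _ _ (σ.naturality γ) (τ.naturality γ)
  nat_hcomp m n := congrArg Glob.sq
    (Lax.OplaxTrans.vComp_naturality_comp σ.toHor τ.toHor (a := ⟨_⟩) (b := ⟨_⟩) (c := ⟨_⟩) m n)
  nat_hid x := congrArg Glob.sq
    (Lax.OplaxTrans.vComp_naturality_id σ.toHor τ.toHor ⟨x⟩)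

end OplaxProtrans

/-- A modification bounded by oplax protransformations and natural transformations. -/
@[ext]
structure Modification {F G H K : LaxDoubleFunctor D E} (σ : OplaxProtrans F G)
    (τ : OplaxProtrans H K) where
  left : F ⟶ H
  right : G ⟶ K
  app (x : D.Obj) : E.Sq (σ.app x) (τ.app x)
  left_app (x : D.Obj) : E.left (app x) = left.app x
  right_app (x : D.Obj) : E.right (app x) = right.app x
  /-- internal equivariance -/
  internal {x y : D.Obj} (f : x ⟶ y) : app x ≫ τ.sq f = σ.sq f ≫ app y
  /-- external equivariance -/
  external {x y : D.Obj} (m : D.Pro x y) :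
    E.hsq (left.sq m) (app y) ((left.right_sq m).trans (left_app y).symm) ≫ τ.nat m =
      σ.nat m ≫ E.hsq (app x) (right.sq m) ((right_app x).trans (right.left_sq m).symm)

instance (D : DoubleCategory.{u₁, v₁, w₁, t₁}) (E : DoubleCategory.{u₂, v₂, w₂, t₂}) :
    Category (ProObj (OplaxProtrans (D := D) (E := E))) where
  Hom σ τ := Modification σ.pro τ.pro
  id σ :=
    { left := 𝟙 σ.src
      right := 𝟙 σ.tgt
      app x := E.one (σ.pro.app x)
      left_app x := by simp
      right_app x := by simp
      internal f := by simp
      external m := by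
        rw [hsq_eq_one _ (LaxDoubleFunctor.id_sq _ m) rfl, Category.id_comp,
          hsq_eq_one _ rfl (LaxDoubleFunctor.id_sq _ m), Category.comp_id] }
  comp {σ τ υ} μ ν :=
    { left := μ.left ≫ ν.left
      right := μ.right ≫ ν.right
      app x := μ.app x ≫ ν.app x
      left_app x := by simp [μ.left_app, ν.left_app]
      right_app x := by simp [μ.right_app, ν.right_app]
      internal f := by
        rw [Category.assoc, ν.internal, ← Category.assoc, μ.internal, Category.assoc]
      external m := by
        have h := hsq_hsq (X := E) _ _ ((μ.left.right_sq m).trans (μ.left_app _).symm) _ _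
          ((ν.left.right_sq m).trans (ν.left_app _).symm)
        have h' := hsq_hsq (X := E) _ _ ((μ.right_app _).trans (μ.right.left_sq m).symm) _ _
          ((ν.right_app _).trans (ν.right.left_sq m).symm)
        refine (congrArg (· ≫ _) h.symm).trans (Eq.trans ?_ (congrArg (_ ≫ ·) h'))
        simp only [Category.assoc]
        rw [ν.external, ← Category.assoc, μ.external, Category.assoc] }
  id_comp μ := Modification.ext (Category.id_comp _) (Category.id_comp _)
    (by funext x; exact Category.id_comp (μ.app x))
  comp_id μ := Modification.ext (Category.comp_id _) (Category.comp_id _)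
    (by funext x; exact Category.comp_id (μ.app x))
  assoc μ ν ξ := Modification.ext (Category.assoc _ _ _) (Category.assoc _ _ _)
    (by funext x; exact Category.assoc (μ.app x) (ν.app x) (ξ.app x))

namespace Modification

variable {F G H : LaxDoubleFunctor D E}

lemma congr_app {σ τ : ProObj (OplaxProtrans (D := D) (E := E))} {μ ν : σ ⟶ τ} (h : μ = ν)
    (x : D.Obj) : Modification.app μ x = Modification.app ν x := by rw [h]

/-- The external identity modification on a natural transformation. -/
def hid (α : F ⟶ G) : Modification (OplaxProtrans.id F) (OplaxProtrans.id G) where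
  left := α
  right := α
  app x := E.hidSq (α.app x)
  left_app x := E.left_hidSq _
  right_app x := E.right_hidSq _
  internal f := by
    change E.hidSq _ ≫ E.hidSq _ = E.hidSq _ ≫ E.hidSq _
    rw [← hidSq_comp, ← hidSq_comp, α.naturality]
  external m := OplaxProtrans.idSq_naturality (α.sq m) (α.left_sq m) (α.right_sq m)

/-- External composition of modifications. -/
def hcomp {F' G' H' : LaxDoubleFunctor D E} {σ : OplaxProtrans F G} {τ : OplaxProtrans G H}
    {σ' : OplaxProtrans F' G'} {τ' : OplaxProtrans G' H'} (μ : Modification σ σ')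
    (ν : Modification τ τ') (h : μ.right = ν.left) : Modification (σ.comp τ) (σ'.comp τ') where
  left := μ.left
  right := ν.right
  app x := E.hsq (μ.app x) (ν.app x) (by rw [μ.right_app, ν.left_app, h])
  left_app x := (E.left_hsq _ _ _).trans (μ.left_app x)
  right_app x := (E.right_hsq _ _ _).trans (ν.right_app x)
  internal f := by
    change E.hsq _ _ _ ≫ E.hsq _ _ _ = E.hsq _ _ _ ≫ E.hsq _ _ _
    rw [hsq_hsq, hsq_hsq]
    exact hsq_congr _ (μ.internal f) (ν.internal f)
  external m := by
    have aux : ∀ (β : G ⟶ G') (hβ : ν.left = β),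
        E.hsq (β.sq m) (ν.app _) ((β.right_sq m).trans (by rw [ν.left_app, hβ])) ≫ τ'.nat m =
          τ.nat m ≫ E.hsq (ν.app _) (ν.right.sq m)
            ((ν.right_app _).trans (ν.right.left_sq m).symm) := by
      rintro _ rfl; exact ν.external m
    exact OplaxProtrans.paste_naturality (hs := σ.right_nat m) (ht := τ.left_nat m)
      (hS := σ'.right_nat m) (hT := τ'.left_nat m) _ _ _ _ _ _ _ _ _ _ _ _ _ (μ.external m) (aux _ h.symm)

/-- A family of globular cells satisfying the equivariance axioms. -/
def ofGlob {σ τ : OplaxProtrans F G} (e : ∀ x, Glob (σ.app x) (τ.app x))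
    (h₁ : ∀ {x y : D.Obj} (f : x ⟶ y), (e x).sq ≫ τ.sq f = σ.sq f ≫ (e y).sq)
    (h₂ : ∀ {x y : D.Obj} (m : D.Pro x y),
      E.hsq (E.one (F.pro m)) (e y).sq (by simp) ≫ τ.nat m =
        σ.nat m ≫ E.hsq (e x).sq (E.one (G.pro m)) (by simp)) : Modification σ τ where
  left := 𝟙 F
  right := 𝟙 G
  app x := (e x).sq
  left_app x := (e x).left
  right_app x := (e x).right
  internal := h₁
  external := h₂

/-- Invertible globular modifications. -/
def isoOfGlob {σ τ : OplaxProtrans F G} (e : ∀ x, σ.app x ≅ τ.app x)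
    (h₁ : ∀ {x y : D.Obj} (f : x ⟶ y), (e x).hom.sq ≫ τ.sq f = σ.sq f ≫ (e y).hom.sq)
    (h₂ : ∀ {x y : D.Obj} (m : D.Pro x y),
      E.hsq (E.one (F.pro m)) (e y).hom.sq (by simp) ≫ τ.nat m =
        σ.nat m ≫ E.hsq (e x).hom.sq (E.one (G.pro m)) (by simp)) :
    ProObj.mk (Pro := OplaxProtrans (D := D) (E := E)) σ ≅ ProObj.mk τ where
  hom := ofGlob (fun x => (e x).hom) h₁ h₂
  inv := ofGlob (fun x => (e x).inv)
    (fun {x y} f => by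
      have hx := congrArg Glob.sq (e x).inv_hom_id
      have hy := congrArg Glob.sq (e y).hom_inv_id
      change (e x).inv.sq ≫ (e x).hom.sq = 𝟙 _ at hx
      change (e y).hom.sq ≫ (e y).inv.sq = 𝟙 _ at hy
      rw [← Category.comp_id (_ ≫ σ.sq f), ← hy, Category.assoc, ← Category.assoc (σ.sq f),
        ← h₁, Category.assoc, ← Category.assoc, hx, Category.id_comp])
    (fun {x y} m => by
      have hx := congrArg Glob.sq (e x).hom_inv_id
      have hy := congrArg Glob.sq (e y).inv_hom_id
      change (e x).hom.sq ≫ (e x).inv.sq = 𝟙 _ at hx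
      change (e y).inv.sq ≫ (e y).hom.sq = 𝟙 _ at hy
      have h : E.hsq (e x).hom.sq (E.one (G.pro m)) (by simp) ≫
          E.hsq (e x).inv.sq (E.one (G.pro m)) (by simp) = 𝟙 _ := by
        rw [hsq_hsq]; exact hsq_eq_one _ hx (Category.comp_id _)
      have h' : E.hsq (E.one (F.pro m)) (e y).inv.sq (by simp) ≫
          E.hsq (E.one (F.pro m)) (e y).hom.sq (by simp) = 𝟙 _ := by
        rw [hsq_hsq]; exact hsq_eq_one _ (Category.comp_id _) hy
      rw [← Category.comp_id (_ ≫ σ.nat m), ← h, Category.assoc, ← Category.assoc (σ.nat m),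
        ← h₂, Category.assoc, ← Category.assoc, h', Category.id_comp])
  hom_inv_id := Modification.ext (Category.comp_id (𝟙 F)) (Category.comp_id (𝟙 G))
    (by funext x; exact congrArg Glob.sq (e x).hom_inv_id)
  inv_hom_id := Modification.ext (Category.comp_id (𝟙 F)) (Category.comp_id (𝟙 G))
    (by funext x; exact congrArg Glob.sq (e x).inv_hom_id)

end Modification

open scoped Lax.OplaxTrans in
/-- The double category of lax double functors, natural transformations, oplax protransformations
and modifications. -/
def LaxOpl (D : DoubleCategory.{u₁, v₁, w₁, t₁}) (E : DoubleCategory.{u₂, v₂, w₂, t₂}) :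
    DoubleCategory where
  Obj := LaxDoubleFunctor D E
  Pro F G := OplaxProtrans F G
  left μ := Modification.left μ
  right μ := Modification.right μ
  left_one _ := rfl
  right_one _ := rfl
  left_comp _ _ := rfl
  right_comp _ _ := rfl
  hid F := OplaxProtrans.id F
  hidSq α := Modification.hid α
  left_hidSq _ := rfl
  right_hidSq _ := rfl
  hidSq_id F := Modification.ext rfl rfl (by funext x; exact E.hidSq_id _)
  hidSq_comp α β := Modification.ext rfl rfl (by funext x; exact E.hidSq_comp _ _)
  hcomp σ τ := σ.comp τ
  hsq μ ν h := Modification.hcomp μ ν h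
  left_hsq _ _ _ := rfl
  right_hsq _ _ _ := rfl
  hsq_one σ τ := Modification.ext rfl rfl (by funext x; exact E.hsq_one (σ.app x) (τ.app x))
  hsq_comp μ ν h μ' ν' h' := Modification.ext rfl rfl (by
    funext x
    exact E.hsq_comp (Modification.app μ x) (Modification.app ν x) _ (Modification.app μ' x)
      (Modification.app ν' x) _)
  assoc σ τ υ := Modification.isoOfGlob
    (fun x => Bicategory.associator (B := Hor E) (a := ⟨_⟩) (b := ⟨_⟩) (c := ⟨_⟩) (d := ⟨_⟩)
      (σ.app x) (τ.app x) (υ.app x))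
    (fun f => (E.assoc_naturality _ _ _ _ _).symm)
    (fun {x y} m => congrArg Glob.sq ((Lax.OplaxTrans.associator σ.toHor τ.toHor
      υ.toHor).hom.as.naturality (a := ⟨x⟩) (b := ⟨y⟩) m))
  left_assoc _ _ _ := rfl
  right_assoc _ _ _ := rfl
  assoc_naturality μ ν ξ h h' := Modification.ext
    ((Category.comp_id _).trans (Category.id_comp _).symm)
    ((Category.comp_id _).trans (Category.id_comp _).symm)
    (by
      funext x
      exact E.assoc_naturality (Modification.app μ x) (Modification.app ν x)
        (Modification.app ξ x) _ _)
  lunit {F G} σ := Modification.isoOfGlob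
    (fun x => Bicategory.leftUnitor (B := Hor E) (a := ⟨_⟩) (b := ⟨_⟩) (σ.app x))
    (fun f => (lunit_naturality' _ (σ.left_sq f)).symm)
    (fun {x y} m => congrArg Glob.sq ((Lax.OplaxTrans.leftUnitor
      σ.toHor).hom.as.naturality (a := ⟨x⟩) (b := ⟨y⟩) m))
  left_lunit _ := rfl
  right_lunit _ := rfl
  lunit_naturality μ := Modification.ext
    ((Category.comp_id _).trans (Category.id_comp _).symm)
    ((Category.comp_id _).trans (Category.id_comp _).symm)
    (by funext x; exact lunit_naturality' (Modification.app μ x) (Modification.left_app μ x))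
  runit {F G} σ := Modification.isoOfGlob
    (fun x => Bicategory.rightUnitor (B := Hor E) (a := ⟨_⟩) (b := ⟨_⟩) (σ.app x))
    (fun f => (runit_naturality' _ (σ.right_sq f)).symm)
    (fun {x y} m => congrArg Glob.sq ((Lax.OplaxTrans.rightUnitor
      σ.toHor).hom.as.naturality (a := ⟨x⟩) (b := ⟨y⟩) m))
  left_runit _ := rfl
  right_runit _ := rfl
  runit_naturality μ := Modification.ext
    ((Category.comp_id _).trans (Category.id_comp _).symm)
    ((Category.comp_id _).trans (Category.id_comp _).symm)
    (by funext x; exact runit_naturality' (Modification.app μ x) (Modification.right_app μ x))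
  pentagon σ τ υ φ := Modification.ext
    (Category.id_comp ((𝟙 _ : (_ : LaxDoubleFunctor D E) ⟶ _) ≫ 𝟙 _))
    (Category.id_comp ((𝟙 _ : (_ : LaxDoubleFunctor D E) ⟶ _) ≫ 𝟙 _)) (by funext x; exact E.pentagon (σ.app x) (τ.app x) (υ.app x) (φ.app x))
  triangle σ τ := Modification.ext (Category.id_comp _) (Category.id_comp _)
    (by funext x; exact E.triangle (σ.app x) (τ.app x))

lemma isIso_hsq {X : DoubleCategory.{u, v, w, t}} {x y z x' y' z' : X.Obj} {m : X.Pro x y}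
    {n : X.Pro y z} {m' : X.Pro x' y'} {n' : X.Pro y' z'} (α : X.Sq m m') (β : X.Sq n n')
    (h : X.right α = X.left β) [IsIso α] [IsIso β] : IsIso (X.hsq α β h) := by
  have h' : X.right (inv α) = X.left (inv β) := by
    have h₁ : X.left β ≫ X.left (inv β) = 𝟙 _ := by
      rw [← left_comp, IsIso.hom_inv_id, left_one]
    rw [← Category.comp_id (X.right (inv α)), ← h₁, ← h, ← Category.assoc, right_isIso_inv,
      Category.id_comp]
  exact ⟨X.hsq (inv α) (inv β) h', by rw [hsq_hsq]; exact hsq_eq_one _ (by simp) (by simp),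
    by rw [hsq_hsq]; exact hsq_eq_one _ (by simp) (by simp)⟩

instance (X : DoubleCategory.{u, v, w, t}) (K : ∀ ⦃x y : X.Obj⦄, X.Pro x y → Prop) :
    Category (ProObj fun x y : X.Obj => {m : X.Pro x y // K m}) where
  Hom m n := X.Sq m.pro.1 n.pro.1
  id m := X.one m.pro.1
  comp α β := α ≫ β
  id_comp α := Category.id_comp (X := ProObj.mk _) α
  comp_id α := Category.comp_id (Y := ProObj.mk _) α
  assoc α β γ := Category.assoc (W := ProObj.mk _) (X := ProObj.mk _) α β γ

/-- The double category obtained by keeping only some of the proarrows. -/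
def restrictPro (X : DoubleCategory.{u, v, w, t}) (K : ∀ ⦃x y : X.Obj⦄, X.Pro x y → Prop)
    (hK : ∀ x, K (X.hid x))
    (hK' : ∀ ⦃x y z⦄ (m : X.Pro x y) (n : X.Pro y z), K m → K n → K (X.hcomp m n)) :
    DoubleCategory.{u, v, w, t} where
  Obj := X.Obj
  Pro x y := {m : X.Pro x y // K m}
  left {m n} α := X.left (m := ProObj.mk m.pro.1) (n := ProObj.mk n.pro.1) α
  right {m n} α := X.right (m := ProObj.mk m.pro.1) (n := ProObj.mk n.pro.1) α
  left_one _ := X.left_one _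
  right_one _ := X.right_one _
  left_comp _ _ := X.left_comp _ _
  right_comp _ _ := X.right_comp _ _
  hid x := ⟨X.hid x, hK x⟩
  hidSq f := X.hidSq f
  left_hidSq _ := X.left_hidSq _
  right_hidSq _ := X.right_hidSq _
  hidSq_id _ := X.hidSq_id _
  hidSq_comp _ _ := X.hidSq_comp _ _
  hcomp m n := ⟨X.hcomp m.1 n.1, hK' m.1 n.1 m.2 n.2⟩
  hsq α β h := X.hsq α β h
  left_hsq _ _ _ := X.left_hsq _ _ _
  right_hsq _ _ _ := X.right_hsq _ _ _
  hsq_one m n := X.hsq_one m.1 n.1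
  hsq_comp α β h α' β' h' := X.hsq_comp α β h α' β' h'
  assoc m n p :=
    { hom := (X.assoc m.1 n.1 p.1).hom
      inv := (X.assoc m.1 n.1 p.1).inv
      hom_inv_id := (X.assoc m.1 n.1 p.1).hom_inv_id
      inv_hom_id := (X.assoc m.1 n.1 p.1).inv_hom_id }
  left_assoc _ _ _ := X.left_assoc _ _ _
  right_assoc _ _ _ := X.right_assoc _ _ _
  assoc_naturality α β γ h h' := X.assoc_naturality α β γ h h'
  lunit m :=
    { hom := (X.lunit m.1).hom
      inv := (X.lunit m.1).inv
      hom_inv_id := (X.lunit m.1).hom_inv_id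
      inv_hom_id := (X.lunit m.1).inv_hom_id }
  left_lunit _ := X.left_lunit _
  right_lunit _ := X.right_lunit _
  lunit_naturality α := X.lunit_naturality α
  runit m :=
    { hom := (X.runit m.1).hom
      inv := (X.runit m.1).inv
      hom_inv_id := (X.runit m.1).hom_inv_id
      inv_hom_id := (X.runit m.1).inv_hom_id }
  left_runit _ := X.left_runit _
  right_runit _ := X.right_runit _
  runit_naturality α := X.runit_naturality α
  pentagon m n p q := X.pentagon m.1 n.1 p.1 q.1
  triangle m n := X.triangle m.1 n.1

/-- A protransformation is pseudo if its naturality comparisons are invertible. -/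
def OplaxProtrans.IsPseudo {F G : LaxDoubleFunctor D E} (σ : OplaxProtrans F G) : Prop :=
  ∀ ⦃x y : D.Obj⦄ (m : D.Pro x y), IsIso (σ.nat m)

lemma OplaxProtrans.isIso_paste {x₀ x₁ x₂ y₀ y₁ y₂ : E.Obj} {a : E.Pro x₀ y₀} {b : E.Pro x₁ y₁}
    {c : E.Pro x₂ y₂} {p : E.Pro x₀ x₁} {q : E.Pro x₁ x₂} {p' : E.Pro y₀ y₁} {q' : E.Pro y₁ y₂}
    (s : E.Sq (E.hcomp a p') (E.hcomp p b)) (t : E.Sq (E.hcomp b q') (E.hcomp q c))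
    (hs : E.right s = 𝟙 _) (ht : E.left t = 𝟙 _) [IsIso s] [IsIso t] :
    IsIso (paste s t hs ht) := by
  have := isIso_hsq s (E.one q') (by simp [hs])
  have := isIso_hsq (E.one p) t (by simp [ht])
  unfold paste
  infer_instance

/-- The double category of lax double functors, natural transformations, pseudo protransformations
and modifications. -/
def LaxPs (D : DoubleCategory.{u₁, v₁, w₁, t₁}) (E : DoubleCategory.{u₂, v₂, w₂, t₂}) :
    DoubleCategory :=
  (LaxOpl D E).restrictPro
    (fun (F G : LaxDoubleFunctor D E) (σ : OplaxProtrans F G) => σ.IsPseudo)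
    (fun (F : LaxDoubleFunctor D E) x y m => by
      change IsIso ((E.runit (F.pro m)).hom ≫ (E.lunit (F.pro m)).inv)
      infer_instance)
    (fun (F G H : LaxDoubleFunctor D E) (σ : OplaxProtrans F G) (τ : OplaxProtrans G H)
        hσ hτ x y m => by
      have := hσ m
      have := hτ m
      exact OplaxProtrans.isIso_paste (σ.nat m) (τ.nat m) (σ.right_nat m) (τ.left_nat m))

section companions

variable {X : DoubleCategory.{u, v, w, t}}

/-- A companion of an arrow: a proarrow with unit and counit binding cells. -/
structure Companion {x y : X.Obj} (f : x ⟶ y) where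
  pro : X.Pro x y
  unit : X.Sq (X.hid x) pro
  counit : X.Sq pro (X.hid y)
  left_unit : X.left unit = 𝟙 x
  right_unit : X.right unit = f
  left_counit : X.left counit = f
  right_counit : X.right counit = 𝟙 y
  unit_counit : unit ≫ counit = X.hidSq f
  hsq_unit_counit :
    (X.lunit pro).inv ≫ X.hsq unit counit (right_unit.trans left_counit.symm) ≫
      (X.runit pro).hom = X.one pro

attribute [simp] Companion.left_unit Companion.right_unit Companion.left_counit
  Companion.right_counit

/-- The globular cell `m ⊙ g_! ⟶ f_! ⊙ n` obtained from a cell `α` with boundary arrows `f`, `g` by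
sliding these arrows into chosen companions. -/
def slide {x y x' y' : X.Obj} {m : X.Pro x y} {n : X.Pro x' y'} {f : x ⟶ x'} {g : y ⟶ y'}
    (cf : Companion f) (cg : Companion g) (α : X.Sq m n) (hf : X.left α = f)
    (hg : X.right α = g) : X.Sq (X.hcomp m cg.pro) (X.hcomp cf.pro n) :=
  (X.lunit _).inv ≫ X.hsq cf.unit (X.hsq α cg.counit (by simp [hg])) (by simp [hf]) ≫
    X.hsq (X.one cf.pro) (X.runit n).hom (by simp)

/-- A cell is a commuter if its boundary arrows have companions and the globular cell obtained by
sliding is invertible (this does not depend on the companions). -/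
def IsCommuter {x y x' y' : X.Obj} {m : X.Pro x y} {n : X.Pro x' y'} (α : X.Sq m n) : Prop :=
  ∃ (cf : Companion (X.left α)) (cg : Companion (X.right α)), IsIso (slide cf cg α rfl rfl)

lemma unitors_hid (x : X.Obj) : (X.lunit (X.hid x)).hom = (X.runit (X.hid x)).hom :=
  congrArg Glob.sq (Bicategory.unitors_equal (B := Hor X) (a := ⟨x⟩))

lemma unitors_inv_hid (x : X.Obj) : (X.lunit (X.hid x)).inv = (X.runit (X.hid x)).inv :=
  congrArg Glob.sq (Bicategory.unitors_inv_equal (B := Hor X) (a := ⟨x⟩))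

/-- The identity companion. -/
def Companion.id (x : X.Obj) : Companion (𝟙 x) where
  pro := X.hid x
  unit := X.one _
  counit := X.one _
  left_unit := by simp
  right_unit := by simp
  left_counit := by simp
  right_counit := by simp
  unit_counit := by simp
  hsq_unit_counit := by simp [← unitors_hid]

lemma slide_id {x y : X.Obj} (m : X.Pro x y) :
    IsIso (slide (Companion.id x) (Companion.id y) (X.one m) (by simp) (by simp)) := by
  have := isIso_hsq (X.one (X.hid x)) (X.runit m).hom (by simp)
  have h : X.hsq (X.one (X.hid x)) (X.hsq (X.one m) (X.one (X.hid y)) (by simp)) (by simp) = 𝟙 _ :=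
    hsq_eq_one _ rfl (hsq_eq_one _ rfl rfl)
  have : IsIso (X.hsq (X.one (X.hid x)) (X.hsq (X.one m) (X.one (X.hid y)) (by simp))
    (by simp)) := by rw [h]; infer_instance
  change IsIso ((X.lunit _).inv ≫ X.hsq (X.one _) (X.hsq (X.one m) (X.one _) _) _ ≫
    X.hsq (X.one _) (X.runit m).hom _)
  infer_instance

lemma lunit_hcomp {x y z : X.Obj} (m : X.Pro x y) (n : X.Pro y z) :
    (X.assoc (X.hid x) m n).inv ≫ X.hsq (X.lunit m).hom (X.one n) (by simp) =
      (X.lunit (X.hcomp m n)).hom :=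
  (congrArg Glob.sq (Bicategory.leftUnitor_comp (B := Hor X) (a := ⟨x⟩) (b := ⟨y⟩) (c := ⟨z⟩)
    m n)).symm

lemma lunit_inv_hcomp {x y z : X.Obj} (m : X.Pro x y) (n : X.Pro y z) :
    (X.lunit (X.hcomp m n)).inv ≫ (X.assoc (X.hid x) m n).inv =
      X.hsq (X.lunit m).inv (X.one n) (by simp) := by
  have h : X.hsq (X.lunit m).inv (X.one n) (by simp) ≫
      X.hsq (X.lunit m).hom (X.one n) (by simp) = 𝟙 _ := by
    rw [hsq_hsq]; exact hsq_eq_one _ (by simp) (by simp)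
  have := isIso_hsq (X.lunit m).hom (X.one n) (by simp)
  rw [← cancel_mono (X.hsq (X.lunit m).hom (X.one n) (by simp)), h, Category.assoc, lunit_hcomp,
    Iso.inv_hom_id]

lemma runit_hcomp {x y z : X.Obj} (m : X.Pro x y) (n : X.Pro y z) :
    (X.assoc m n (X.hid z)).inv ≫ (X.runit (X.hcomp m n)).hom =
      X.hsq (X.one m) (X.runit n).hom (by simp) := by
  rw [Iso.inv_comp_eq]
  exact congrArg Glob.sq (Bicategory.rightUnitor_comp (B := Hor X) (a := ⟨x⟩) (b := ⟨y⟩)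
    (c := ⟨z⟩) m n)

/-- Composition of companions. -/
def Companion.comp {x y z : X.Obj} {f : x ⟶ y} {g : y ⟶ z} (cf : Companion f)
    (cg : Companion g) : Companion (f ≫ g) where
  pro := X.hcomp cf.pro cg.pro
  unit := cf.unit ≫ (X.runit cf.pro).inv ≫ X.hsq (X.one cf.pro) cg.unit (by simp)
  counit := X.hsq cf.counit (X.one cg.pro) (by simp) ≫ (X.lunit cg.pro).hom ≫ cg.counit
  left_unit := by simp
  right_unit := by simp
  left_counit := by simp
  right_counit := by simp
  unit_counit := by
    have h : X.hsq (X.one cf.pro) cg.unit (by simp) ≫ X.hsq cf.counit (X.one cg.pro) (by simp) =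
        X.hsq cf.counit (X.hidSq (𝟙 _)) (by simp) ≫ X.hsq (X.hidSq (𝟙 _)) cg.unit (by simp) := by
      rw [hsq_hsq, hsq_hsq]; exact hsq_congr _ (by simp) (by simp)
    simp only [Category.assoc]
    rw [← Category.assoc (X.hsq (X.one cf.pro) cg.unit _), h, Category.assoc,
      lunit_naturality'_assoc cg.unit cg.left_unit, unitors_hid,
      runit_naturality'_assoc cf.counit cf.right_counit, Iso.inv_hom_id_assoc, cg.unit_counit,
      ← Category.assoc, cf.unit_counit, hidSq_comp]
  hsq_unit_counit := by
    have e₁ : X.hsq (cf.unit ≫ (X.runit cf.pro).inv ≫ X.hsq (X.one cf.pro) cg.unit (by simp))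
        (X.hsq cf.counit (X.one cg.pro) (by simp) ≫ (X.lunit cg.pro).hom ≫ cg.counit) (by simp) =
        X.hsq cf.unit (X.hsq cf.counit (X.one cg.pro) (by simp)) (by simp) ≫
          X.hsq (X.runit cf.pro).inv (X.lunit cg.pro).hom (by simp) ≫
          X.hsq (X.hsq (X.one cf.pro) cg.unit (by simp)) cg.counit (by simp) := by
      rw [hsq_hsq, hsq_hsq]
    have e₂ : (X.lunit (X.hcomp cf.pro cg.pro)).inv ≫
        X.hsq cf.unit (X.hsq cf.counit (X.one cg.pro) (by simp)) (by simp) =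
        X.hsq (X.runit cf.pro).inv (X.one cg.pro) (by simp) ≫ (X.assoc _ _ _).hom := by
      rw [← cancel_mono (X.assoc _ _ _).inv, Category.assoc, Category.assoc, Iso.hom_inv_id,
        Category.comp_id, assoc_inv_naturality _ _ _ (by simp) (by simp), ← Category.assoc,
        lunit_inv_hcomp, hsq_hsq]
      refine hsq_congr _ ?_ (Category.comp_id _)
      rw [← cancel_mono (X.runit cf.pro).hom, Iso.inv_hom_id, Category.assoc]
      exact cf.hsq_unit_counit
    have e₃ : X.hsq (X.hsq (X.one cf.pro) cg.unit (by simp)) cg.counit (by simp) ≫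
        (X.runit (X.hcomp cf.pro cg.pro)).hom =
        (X.assoc _ _ _).hom ≫ X.hsq (X.one cf.pro) (X.lunit cg.pro).hom (by simp) := by
      rw [← Iso.inv_comp_eq, ← assoc_inv_naturality_assoc _ _ _ (by simp) (by simp), runit_hcomp,
        hsq_hsq]
      refine hsq_congr _ (Category.comp_id _) ?_
      rw [← cancel_epi (X.lunit cg.pro).inv, Iso.inv_hom_id]
      exact cg.hsq_unit_counit
    rw [e₁]
    simp only [Category.assoc]
    rw [e₃, ← Category.assoc, e₂, X.triangle, hsq_hsq, Category.assoc,
      hsq_congr _ (Iso.inv_hom_id _) (Category.comp_id _), X.triangle, hsq_hsq]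
    exact hsq_eq_one _ (Iso.inv_hom_id _) (Category.comp_id _)

lemma Companion.comp_unit {x y z : X.Obj} {f : x ⟶ y} {g : y ⟶ z} (cf : Companion f)
    (cg : Companion g) : (cf.comp cg).unit =
      (X.lunit (X.hid x)).inv ≫ X.hsq cf.unit (X.hidSq f ≫ cg.unit) (by simp) := by
  change cf.unit ≫ (X.runit cf.pro).inv ≫ X.hsq (X.one cf.pro) cg.unit _ = _
  rw [runit_inv_naturality_assoc, hsq_hsq, unitors_inv_hid]
  congr 1
  exact hsq_congr _ (Category.comp_id _) (by simp)

lemma unit_slide {x y x' y' : X.Obj} {m : X.Pro x y} {n : X.Pro x' y'} {f : x ⟶ x'} {g : y ⟶ y'}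
    (cf : Companion f) (cg : Companion g) (α : X.Sq m n) (hf : X.left α = f)
    (hg : X.right α = g) :
    X.hsq (X.one m) cg.unit (by simp) ≫ slide cf cg α hf hg =
      ((X.runit m).hom ≫ (X.lunit m).inv) ≫ X.hsq cf.unit α (by simp [hf]) := by
  unfold slide
  have e : X.hsq α (X.hidSq g) (by simp [hg]) ≫ (X.runit n).hom = (X.runit m).hom ≫ α :=
    runit_naturality' α hg
  rw [lunit_inv_naturality_assoc, hsq_hsq, hsq_hsq, Category.assoc,
    lunit_inv_naturality_assoc (X.runit m).hom, hsq_hsq]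
  congr 1
  refine hsq_congr _ ?_ ?_
  · simp
  · rw [← Category.assoc, hsq_hsq, hsq_congr _ (Category.id_comp α) cg.unit_counit, e]

lemma eq_slide {x y x' y' : X.Obj} {m : X.Pro x y} {n : X.Pro x' y'} {f : x ⟶ x'} {g : y ⟶ y'}
    (cf : Companion f) (cg : Companion g) (α : X.Sq m n) (hf : X.left α = f)
    (hg : X.right α = g) (β : X.Sq (X.hcomp m cg.pro) (X.hcomp cf.pro n)) (hβ : X.right β = 𝟙 _)
    (h : X.hsq (X.one m) cg.unit (by simp) ≫ β =
      ((X.runit m).hom ≫ (X.lunit m).inv) ≫ X.hsq cf.unit α (by simp [hf])) :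
    β = slide cf cg α hf hg := by
  have e₁ : X.hsq (X.one m) (X.lunit cg.pro).inv (by simp) ≫
      X.hsq (X.one m) (X.hsq cg.unit cg.counit (by simp)) (by simp) ≫
      X.hsq (X.one m) (X.runit cg.pro).hom (by simp) = 𝟙 _ := by
    rw [hsq_hsq, hsq_hsq]
    exact hsq_eq_one _ (by simp) cg.hsq_unit_counit
  have e₂ : X.hsq (X.hsq (X.one m) cg.unit (by simp)) cg.counit (by simp) ≫
      X.hsq β (X.hidSq (𝟙 _)) (by simp [hβ]) =
      X.hsq ((X.runit m).hom ≫ (X.lunit m).inv) (X.one _) (by simp) ≫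
        X.hsq (X.hsq cf.unit α (by simp [hf])) cg.counit (by simp [hg]) := by
    rw [hsq_hsq, hsq_hsq]
    exact hsq_congr _ h (by simp)
  have e₃ : X.hsq (X.one m) (X.lunit cg.pro).inv (by simp) ≫ (X.assoc _ _ _).inv ≫
      X.hsq ((X.runit m).hom ≫ (X.lunit m).inv) (X.one cg.pro) (by simp) =
      (X.lunit _).inv ≫ (X.assoc _ _ _).inv := by
    rw [lunit_inv_hcomp]
    have : X.hsq ((X.runit m).hom ≫ (X.lunit m).inv) (X.one cg.pro) (by simp) =
        X.hsq (X.runit m).hom (X.one cg.pro) (by simp) ≫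
          X.hsq (X.lunit m).inv (X.one cg.pro) (by simp) := by
      rw [hsq_hsq]; exact hsq_congr _ rfl (by simp)
    rw [this, ← X.triangle]
    simp only [Category.assoc]
    rw [Iso.inv_hom_id_assoc, ← Category.assoc, hsq_hsq,
      hsq_eq_one _ (Category.comp_id _) (Iso.inv_hom_id _), Category.id_comp]
  unfold slide
  rw [← Category.id_comp β, ← e₁]
  simp only [Category.assoc]
  rw [← runit_hcomp m cg.pro, Category.assoc, ← runit_naturality' β hβ,
    assoc_inv_naturality_assoc _ _ _ (by simp) (by simp), ← Category.assoc (X.hsq (X.hsq _ _ _) _ _),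
    e₂]
  simp only [Category.assoc]
  rw [← Category.assoc (X.assoc _ _ _).inv, ← Category.assoc (X.hsq (X.one m) _ _), e₃,
    Category.assoc, ← assoc_inv_naturality_assoc _ _ _ (by simp [hf]) (by simp [hg]), runit_hcomp]

lemma paste_coherence {x y : X.Obj} (m : X.Pro x y) :
    X.hsq (X.one m) (X.lunit (X.hid y)).inv (by simp) ≫
        OplaxProtrans.paste ((X.runit m).hom ≫ (X.lunit m).inv) ((X.runit m).hom ≫ (X.lunit m).inv)
          (by simp) (by simp) =
      ((X.runit m).hom ≫ (X.lunit m).inv) ≫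
        X.hsq (X.lunit (X.hid x)).inv (X.one m) (by simp) := by
  have := (by intro a b m; bicategory : ∀ {a b : Hor X} (m : a ⟶ b),
    Bicategory.whiskerLeft m (Bicategory.leftUnitor (𝟙 b)).inv ≫
      (Bicategory.associator m (𝟙 b) (𝟙 b)).inv ≫
      Bicategory.whiskerRight ((Bicategory.rightUnitor m).hom ≫ (Bicategory.leftUnitor m).inv)
        (𝟙 b) ≫ (Bicategory.associator (𝟙 a) m (𝟙 b)).hom ≫
      Bicategory.whiskerLeft (𝟙 a) ((Bicategory.rightUnitor m).hom ≫
        (Bicategory.leftUnitor m).inv) ≫ (Bicategory.associator (𝟙 a) (𝟙 a) m).inv =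
    ((Bicategory.rightUnitor m).hom ≫ (Bicategory.leftUnitor m).inv) ≫
      Bicategory.whiskerRight (Bicategory.leftUnitor (𝟙 a)).inv m)
  exact congrArg Glob.sq (this (a := ⟨x⟩) (b := ⟨y⟩) m)

lemma right_paste {x₀ x₁ x₂ y₀ y₁ y₂ : X.Obj} {a : X.Pro x₀ y₀} {b : X.Pro x₁ y₁}
    {c : X.Pro x₂ y₂} {p : X.Pro x₀ x₁} {q : X.Pro x₁ x₂} {p' : X.Pro y₀ y₁} {q' : X.Pro y₁ y₂}
    (s : X.Sq (X.hcomp a p') (X.hcomp p b)) (t : X.Sq (X.hcomp b q') (X.hcomp q c))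
    (hs : X.right s = 𝟙 _) (ht : X.left t = 𝟙 _) :
    X.right (OplaxProtrans.paste s t hs ht) = X.right t := by
  simp [OplaxProtrans.paste]

lemma slide_comp {x y x' y' x'' y'' : X.Obj} {m : X.Pro x y} {m' : X.Pro x' y'}
    {m'' : X.Pro x'' y''} {f : x ⟶ x'} {g : y ⟶ y'} {f' : x' ⟶ x''} {g' : y' ⟶ y''}
    (cf : Companion f) (cg : Companion g) (cf' : Companion f') (cg' : Companion g')
    (α : X.Sq m m') (α' : X.Sq m' m'') (hf : X.left α = f) (hg : X.right α = g)
    (hf' : X.left α' = f') (hg' : X.right α' = g') :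
    OplaxProtrans.paste (slide cf cg α hf hg) (slide cf' cg' α' hf' hg')
        (by simp [slide]) (by simp [slide]) =
      slide (cf.comp cf') (cg.comp cg') (α ≫ α') (by simp [hf, hf']) (by simp [hg, hg']) := by
  refine eq_slide (cf.comp cf') (cg.comp cg') _ _ _ _ ((right_paste _ _ _ _).trans (by simp [slide])) ?_
  have e₁ := unit_slide cf cg α hf hg
  have e₂ : X.hsq α (X.hidSq g ≫ cg'.unit) (by simp [hg]) ≫ slide cf' cg' α' hf' hg' =
      ((X.runit m).hom ≫ (X.lunit m).inv) ≫
        X.hsq (X.hidSq f ≫ cf'.unit) (α ≫ α') (by simp [hf, hf']) := by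
    have h : X.hsq α (X.hidSq g ≫ cg'.unit) (by simp [hg]) =
        X.hsq α (X.hidSq g) (by simp [hg]) ≫ X.hsq (X.one m') cg'.unit (by simp) := by
      rw [hsq_hsq]; exact hsq_congr _ (by simp) rfl
    rw [h, Category.assoc, unit_slide, ← Category.assoc,
      OplaxProtrans.idSq_naturality α hf hg, Category.assoc, hsq_hsq]
  have e₃ := OplaxProtrans.paste_naturality (hs := by simp) (ht := by simp)
    (hS := by simp [slide]) (hT := by simp [slide])
    (X.one m) α (α ≫ α') cf.unit (X.hidSq f ≫ cf'.unit)
    cg.unit (X.hidSq g ≫ cg'.unit) (by simp) (by simp [hf]) (by simp [hg]) (by simp [hf, hf'])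
    (by simp) (by simp) e₁ e₂
  have h : X.hsq (X.one m) (cg.comp cg').unit (by simp) =
      X.hsq (X.one m) (X.lunit (X.hid y)).inv (by simp) ≫
        X.hsq (X.one m) (X.hsq cg.unit (X.hidSq g ≫ cg'.unit) (by simp)) (by simp) := by
    rw [hsq_hsq]; exact hsq_congr _ (by simp) (Companion.comp_unit cg cg')
  have h' : X.hsq (cf.comp cf').unit (α ≫ α') (by simp [hf, hf']) =
      X.hsq (X.lunit (X.hid x)).inv (X.one m) (by simp) ≫
        X.hsq (X.hsq cf.unit (X.hidSq f ≫ cf'.unit) (by simp)) (α ≫ α') (by simp [hf, hf']) := by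
    rw [hsq_hsq]; exact hsq_congr _ (Companion.comp_unit cf cf') (by simp)
  refine Eq.trans (congrArg (· ≫ OplaxProtrans.paste (slide cf cg α hf hg)
    (slide cf' cg' α' hf' hg') (by simp [slide]) (by simp [slide])) h) ?_
  refine Eq.trans ?_ (congrArg (((X.runit m).hom ≫ (X.lunit m).inv) ≫ ·) h').symm
  refine (Category.assoc _ _ _).trans ?_
  refine (congrArg (_ ≫ ·) e₃).trans ?_
  rw [← Category.assoc, paste_coherence, Category.assoc]
  rfl

lemma isCommuter_of {x y x' y' : X.Obj} {m : X.Pro x y} {n : X.Pro x' y'} {f : x ⟶ x'}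
    {g : y ⟶ y'} (cf : Companion f) (cg : Companion g) (α : X.Sq m n) (hf : X.left α = f)
    (hg : X.right α = g) (h : IsIso (slide cf cg α hf hg)) : IsCommuter α := by
  subst hf hg; exact ⟨cf, cg, h⟩

lemma isCommuter_id {x y : X.Obj} (m : X.Pro x y) : IsCommuter (X.one m) :=
  isCommuter_of _ _ _ _ _ (slide_id m)

lemma IsCommuter.comp {x y x' y' x'' y'' : X.Obj} {m : X.Pro x y} {m' : X.Pro x' y'}
    {m'' : X.Pro x'' y''} {α : X.Sq m m'} {α' : X.Sq m' m''} (h : IsCommuter α)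
    (h' : IsCommuter α') : IsCommuter (α ≫ α') := by
  obtain ⟨cf, cg, hi⟩ := h
  obtain ⟨cf', cg', hi'⟩ := h'
  refine isCommuter_of (cf.comp cf') (cg.comp cg') _ (by simp) (by simp) ?_
  rw [← slide_comp cf cg cf' cg' α α' rfl rfl rfl rfl]
  exact OplaxProtrans.isIso_paste _ _ _ _

end companions

/-- A strict double category. A cell in `Sq x y x' y'` has the given corners; its boundary consists
of the proarrows `top`, `bot` and of the arrows `left`, `right`. -/
structure StrictDoubleCategory where
  Obj : Type u
  Arr : Obj → Obj → Type v
  arrId (x : Obj) : Arr x x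
  arrComp {x y z : Obj} : Arr x y → Arr y z → Arr x z
  arr_id_comp {x y : Obj} (f : Arr x y) : arrComp (arrId x) f = f
  arr_comp_id {x y : Obj} (f : Arr x y) : arrComp f (arrId y) = f
  arr_assoc {x y z a : Obj} (f : Arr x y) (g : Arr y z) (h : Arr z a) :
    arrComp (arrComp f g) h = arrComp f (arrComp g h)
  Pro : Obj → Obj → Type w
  proId (x : Obj) : Pro x x
  proComp {x y z : Obj} : Pro x y → Pro y z → Pro x z
  pro_id_comp {x y : Obj} (m : Pro x y) : proComp (proId x) m = m
  pro_comp_id {x y : Obj} (m : Pro x y) : proComp m (proId y) = m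
  pro_assoc {x y z a : Obj} (m : Pro x y) (n : Pro y z) (p : Pro z a) :
    proComp (proComp m n) p = proComp m (proComp n p)
  Sq (x y x' y' : Obj) : Type t
  top {x y x' y' : Obj} : Sq x y x' y' → Pro x y
  bot {x y x' y' : Obj} : Sq x y x' y' → Pro x' y'
  left {x y x' y' : Obj} : Sq x y x' y' → Arr x x'
  right {x y x' y' : Obj} : Sq x y x' y' → Arr y y'
  /-- internal identity cells -/
  vid {x y : Obj} (m : Pro x y) : Sq x y x y
  top_vid {x y : Obj} (m : Pro x y) : top (vid m) = m
  bot_vid {x y : Obj} (m : Pro x y) : bot (vid m) = m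
  left_vid {x y : Obj} (m : Pro x y) : left (vid m) = arrId x
  right_vid {x y : Obj} (m : Pro x y) : right (vid m) = arrId y
  /-- internal composition of cells -/
  vcomp {x y x' y' x'' y'' : Obj} (α : Sq x y x' y') (β : Sq x' y' x'' y'') (h : bot α = top β) :
    Sq x y x'' y''
  top_vcomp {x y x' y' x'' y'' : Obj} (α : Sq x y x' y') (β : Sq x' y' x'' y'')
    (h : bot α = top β) : top (vcomp α β h) = top α
  bot_vcomp {x y x' y' x'' y'' : Obj} (α : Sq x y x' y') (β : Sq x' y' x'' y'')
    (h : bot α = top β) : bot (vcomp α β h) = bot β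
  left_vcomp {x y x' y' x'' y'' : Obj} (α : Sq x y x' y') (β : Sq x' y' x'' y'')
    (h : bot α = top β) : left (vcomp α β h) = arrComp (left α) (left β)
  right_vcomp {x y x' y' x'' y'' : Obj} (α : Sq x y x' y') (β : Sq x' y' x'' y'')
    (h : bot α = top β) : right (vcomp α β h) = arrComp (right α) (right β)
  /-- external identity cells -/
  hid {x y : Obj} (f : Arr x y) : Sq x x y y
  left_hid {x y : Obj} (f : Arr x y) : left (hid f) = f
  right_hid {x y : Obj} (f : Arr x y) : right (hid f) = f
  top_hid {x y : Obj} (f : Arr x y) : top (hid f) = proId x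
  bot_hid {x y : Obj} (f : Arr x y) : bot (hid f) = proId y
  /-- external composition of cells -/
  hcomp {x y z x' y' z' : Obj} (α : Sq x y x' y') (β : Sq y z y' z') (h : right α = left β) :
    Sq x z x' z'
  left_hcomp {x y z x' y' z' : Obj} (α : Sq x y x' y') (β : Sq y z y' z')
    (h : right α = left β) : left (hcomp α β h) = left α
  right_hcomp {x y z x' y' z' : Obj} (α : Sq x y x' y') (β : Sq y z y' z')
    (h : right α = left β) : right (hcomp α β h) = right β
  top_hcomp {x y z x' y' z' : Obj} (α : Sq x y x' y') (β : Sq y z y' z')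
    (h : right α = left β) : top (hcomp α β h) = proComp (top α) (top β)
  bot_hcomp {x y z x' y' z' : Obj} (α : Sq x y x' y') (β : Sq y z y' z')
    (h : right α = left β) : bot (hcomp α β h) = proComp (bot α) (bot β)
  vid_vcomp {x y x' y' : Obj} (α : Sq x y x' y') : vcomp (vid (top α)) α (bot_vid _) = α
  vcomp_vid {x y x' y' : Obj} (α : Sq x y x' y') : vcomp α (vid (bot α)) (top_vid _).symm = α
  vcomp_assoc {x y x' y' x'' y'' x₃ y₃ : Obj} (α : Sq x y x' y') (β : Sq x' y' x'' y'')
    (γ : Sq x'' y'' x₃ y₃) (h : bot α = top β) (k : bot β = top γ) :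
    vcomp (vcomp α β h) γ ((bot_vcomp _ _ _).trans k) =
      vcomp α (vcomp β γ k) (h.trans (top_vcomp _ _ _).symm)
  hid_hcomp {x y x' y' : Obj} (α : Sq x y x' y') : hcomp (hid (left α)) α (right_hid _) = α
  hcomp_hid {x y x' y' : Obj} (α : Sq x y x' y') : hcomp α (hid (right α)) (left_hid _).symm = α
  hcomp_assoc {x y z a x' y' z' a' : Obj} (α : Sq x y x' y') (β : Sq y z y' z')
    (γ : Sq z a z' a') (h : right α = left β) (k : right β = left γ) :
    hcomp (hcomp α β h) γ ((right_hcomp _ _ _).trans k) =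
      hcomp α (hcomp β γ k) (h.trans (left_hcomp _ _ _).symm)
  vid_proId (x : Obj) : vid (proId x) = hid (arrId x)
  vid_proComp {x y z : Obj} (m : Pro x y) (n : Pro y z) :
    vid (proComp m n) = hcomp (vid m) (vid n) ((right_vid m).trans (left_vid n).symm)
  hid_arrComp {x y z : Obj} (f : Arr x y) (g : Arr y z) :
    hid (arrComp f g) = vcomp (hid f) (hid g) ((bot_hid f).trans (top_hid g).symm)
  interchange {x y z x' y' z' x'' y'' z'' : Obj} (α : Sq x y x' y') (β : Sq y z y' z')
    (γ : Sq x' y' x'' y'') (δ : Sq y' z' y'' z'') (h : right α = left β) (h' : right γ = left δ)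
    (k : bot α = top γ) (k' : bot β = top δ) :
    vcomp (hcomp α β h) (hcomp γ δ h')
        ((bot_hcomp _ _ _).trans ((congrArg₂ proComp k k').trans (top_hcomp _ _ _).symm)) =
      hcomp (vcomp α γ k) (vcomp β δ k')
        ((right_vcomp _ _ _).trans ((congrArg₂ arrComp h h').trans (left_vcomp _ _ _).symm))

namespace StrictDoubleCategory

/-- The transpose: arrows and proarrows are interchanged. -/
def transpose (X : StrictDoubleCategory.{u, v, w, t}) : StrictDoubleCategory.{u, w, v, t} where
  Obj := X.Obj
  Arr := X.Pro
  arrId := X.proId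
  arrComp := X.proComp
  arr_id_comp := X.pro_id_comp
  arr_comp_id := X.pro_comp_id
  arr_assoc := X.pro_assoc
  Pro := X.Arr
  proId := X.arrId
  proComp := X.arrComp
  pro_id_comp := X.arr_id_comp
  pro_comp_id := X.arr_comp_id
  pro_assoc := X.arr_assoc
  Sq x y x' y' := X.Sq x x' y y'
  top := X.left
  bot := X.right
  left := X.top
  right := X.bot
  vid := X.hid
  top_vid := X.left_hid
  bot_vid := X.right_hid
  left_vid := X.top_hid
  right_vid := X.bot_hid
  vcomp := X.hcomp
  top_vcomp := X.left_hcomp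
  bot_vcomp := X.right_hcomp
  left_vcomp := X.top_hcomp
  right_vcomp := X.bot_hcomp
  hid := X.vid
  left_hid := X.top_vid
  right_hid := X.bot_vid
  top_hid := X.left_vid
  bot_hid := X.right_vid
  hcomp := X.vcomp
  left_hcomp := X.top_vcomp
  right_hcomp := X.bot_vcomp
  top_hcomp := X.left_vcomp
  bot_hcomp := X.right_vcomp
  vid_vcomp := X.hid_hcomp
  vcomp_vid := X.hcomp_hid
  vcomp_assoc := X.hcomp_assoc
  hid_hcomp := X.vid_vcomp
  hcomp_hid := X.vcomp_vid
  hcomp_assoc := X.vcomp_assoc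
  vid_proId x := (X.vid_proId x).symm
  vid_proComp := X.hid_arrComp
  hid_arrComp := X.vid_proComp
  interchange α β γ δ h h' k k' := (X.interchange α γ β δ k k' h h').symm

section

variable {X : StrictDoubleCategory.{u, v, w, t}}

lemma vcomp_congr {x y x' y' x'' y'' : X.Obj} {α α' : X.Sq x y x' y'} {β β' : X.Sq x' y' x'' y''}
    (h : X.bot α = X.top β) (e : α = α') (e' : β = β') :
    X.vcomp α β h = X.vcomp α' β' (by rw [← e, ← e', h]) := by
  subst e e'; rfl

lemma hcomp_congr {x y z x' y' z' : X.Obj} {α α' : X.Sq x y x' y'} {β β' : X.Sq y z y' z'}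
    (h : X.right α = X.left β) (e : α = α') (e' : β = β') :
    X.hcomp α β h = X.hcomp α' β' (by rw [← e, ← e', h]) := by
  subst e e'; rfl

lemma vid_vcomp' {x y x' y' : X.Obj} {m : X.Pro x y} (α : X.Sq x y x' y')
    (h : X.bot (X.vid m) = X.top α) : X.vcomp (X.vid m) α h = α := by
  obtain rfl : m = X.top α := (X.bot_vid m).symm.trans h
  exact X.vid_vcomp α

lemma vcomp_vid' {x y x' y' : X.Obj} {m : X.Pro x' y'} (α : X.Sq x y x' y')
    (h : X.bot α = X.top (X.vid m)) : X.vcomp α (X.vid m) h = α := by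
  obtain rfl : X.bot α = m := h.trans (X.top_vid m)
  exact X.vcomp_vid α

lemma hid_hcomp' {x y x' y' : X.Obj} {f : X.Arr x x'} (α : X.Sq x y x' y')
    (h : X.right (X.hid f) = X.left α) : X.hcomp (X.hid f) α h = α := by
  obtain rfl : f = X.left α := (X.right_hid f).symm.trans h
  exact X.hid_hcomp α

lemma hcomp_hid' {x y x' y' : X.Obj} {f : X.Arr y y'} (α : X.Sq x y x' y')
    (h : X.right α = X.left (X.hid f)) : X.hcomp α (X.hid f) h = α := by
  obtain rfl : X.right α = f := h.trans (X.left_hid f)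
  exact X.hcomp_hid α

/-- The category of proarrows and cells. -/
abbrev sqCategory (X : StrictDoubleCategory.{u, v, w, t}) : Category.{t} (ProObj X.Pro) where
  Hom m n := {α : X.Sq m.src m.tgt n.src n.tgt // X.top α = m.pro ∧ X.bot α = n.pro}
  id m := ⟨X.vid m.pro, X.top_vid _, X.bot_vid _⟩
  comp α β := ⟨X.vcomp α.1 β.1 (α.2.2.trans β.2.1.symm),
    (X.top_vcomp _ _ _).trans α.2.1, (X.bot_vcomp _ _ _).trans β.2.2⟩
  id_comp α := Subtype.ext (vid_vcomp' _ _)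
  comp_id α := Subtype.ext (vcomp_vid' _ _)
  assoc α β γ := Subtype.ext (X.vcomp_assoc _ _ _ _ _)

/-- The category of objects and arrows. -/
abbrev arrCategory (X : StrictDoubleCategory.{u, v, w, t}) : Category.{v} X.Obj where
  Hom := X.Arr
  id := X.arrId
  comp := X.arrComp
  id_comp := X.arr_id_comp
  comp_id := X.arr_comp_id
  assoc := X.arr_assoc

/-- The identity cell between equal proarrows. -/
abbrev isoOfEq (X : StrictDoubleCategory.{u, v, w, t}) {x y : X.Obj} {m n : X.Pro x y}
    (h : m = n) :
    letI := X.sqCategory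
    ProObj.mk m ≅ ProObj.mk n :=
  letI := X.sqCategory
  { hom := ⟨X.vid m, X.top_vid _, (X.bot_vid _).trans h⟩
    inv := ⟨X.vid m, (X.top_vid _).trans h, X.bot_vid _⟩
    hom_inv_id := Subtype.ext (vid_vcomp' _ _)
    inv_hom_id := Subtype.ext ((vid_vcomp' _ _).trans (congrArg X.vid h)) }

/-- A strict double category, regarded as a double category with trivial coherence cells. -/
def toDouble (X : StrictDoubleCategory.{u, v, w, t}) : DoubleCategory.{u, v, w, t} where
  Obj := X.Obj
  cat := X.arrCategory
  Pro := X.Pro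
  sqCat := X.sqCategory
  left α := X.left α.1
  right α := X.right α.1
  left_one _ := X.left_vid _
  right_one _ := X.right_vid _
  left_comp _ _ := X.left_vcomp _ _ _
  right_comp _ _ := X.right_vcomp _ _ _
  hid := X.proId
  hidSq f := ⟨X.hid f, X.top_hid f, X.bot_hid f⟩
  left_hidSq := X.left_hid
  right_hidSq := X.right_hid
  hidSq_id x := Subtype.ext (X.vid_proId x).symm
  hidSq_comp f g := Subtype.ext (X.hid_arrComp f g)
  hcomp := X.proComp
  hsq α β h := ⟨X.hcomp α.1 β.1 h,
    (X.top_hcomp _ _ _).trans (congrArg₂ X.proComp α.2.1 β.2.1),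
    (X.bot_hcomp _ _ _).trans (congrArg₂ X.proComp α.2.2 β.2.2)⟩
  left_hsq _ _ _ := X.left_hcomp _ _ _
  right_hsq _ _ _ := X.right_hcomp _ _ _
  hsq_one m n := Subtype.ext (X.vid_proComp m n).symm
  hsq_comp α β h α' β' h' := Subtype.ext (X.interchange _ _ _ _ _ _ _ _).symm
  assoc m n p := X.isoOfEq (X.pro_assoc m n p)
  left_assoc _ _ _ := X.left_vid _
  right_assoc _ _ _ := X.right_vid _
  assoc_naturality _ _ _ _ _ := Subtype.ext
    ((vcomp_vid' _ _).trans ((X.hcomp_assoc _ _ _ _ _).trans (vid_vcomp' _ _).symm))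
  lunit m := X.isoOfEq (X.pro_id_comp m)
  left_lunit _ := X.left_vid _
  right_lunit _ := X.right_vid _
  lunit_naturality _ := Subtype.ext
    ((vcomp_vid' _ _).trans ((X.hid_hcomp _).trans (vid_vcomp' _ _).symm))
  runit m := X.isoOfEq (X.pro_comp_id m)
  left_runit _ := X.left_vid _
  right_runit _ := X.right_vid _
  runit_naturality _ := Subtype.ext
    ((vcomp_vid' _ _).trans ((X.hcomp_hid _).trans (vid_vcomp' _ _).symm))
  pentagon m n p q := Subtype.ext (by
    refine (vcomp_congr _ (X.vid_proComp _ _).symm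
      (vcomp_congr _ rfl (X.vid_proComp _ _).symm)).trans ?_
    refine (vid_vcomp' _ _).trans ((vid_vcomp' _ _).trans ?_)
    refine Eq.trans ?_ (vid_vcomp' _ _).symm
    exact congrArg X.vid (by simp only [X.pro_assoc]))
  triangle m n := Subtype.ext (by
    refine (vid_vcomp' _ _).trans ?_
    refine (X.vid_proComp _ _).symm.trans (Eq.trans ?_ (X.vid_proComp _ _))
    exact congrArg X.vid (by simp only [X.pro_id_comp, X.pro_comp_id]))

end

end StrictDoubleCategory

section quintets

variable {X : DoubleCategory.{u, v, w, t}}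

/-- Cells of the form `f ⇛ g`, for arrows `f`, `g`, compose externally. -/
def spComp {x y : X.Obj} (α β : X.Sq (X.hid x) (X.hid y)) (h : X.right α = X.left β) :
    X.Sq (X.hid x) (X.hid y) :=
  (X.lunit _).inv ≫ X.hsq α β h ≫ (X.lunit _).hom

@[simp] lemma left_spComp {x y : X.Obj} (α β : X.Sq (X.hid x) (X.hid y))
    (h : X.right α = X.left β) : X.left (spComp α β h) = X.left α := by
  simp [spComp]

@[simp] lemma right_spComp {x y : X.Obj} (α β : X.Sq (X.hid x) (X.hid y))
    (h : X.right α = X.left β) : X.right (spComp α β h) = X.right β := by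
  simp [spComp]

lemma spComp_congr {x y : X.Obj} {α β α' β' : X.Sq (X.hid x) (X.hid y)}
    (h : X.right α = X.left β) (e : α = α') (e' : β = β') :
    spComp α β h = spComp α' β' (by rw [← e, ← e', h]) := by
  subst e e'; rfl

lemma hid_spComp {x y : X.Obj} (α : X.Sq (X.hid x) (X.hid y)) {f : x ⟶ y} (hf : X.left α = f) :
    spComp (X.hidSq f) α (by simp [hf]) = α := by
  unfold spComp
  rw [lunit_naturality' α hf, Iso.inv_hom_id_assoc]

lemma spComp_hid {x y : X.Obj} (α : X.Sq (X.hid x) (X.hid y)) {f : x ⟶ y} (hf : X.right α = f) :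
    spComp α (X.hidSq f) (by simp [hf]) = α := by
  unfold spComp
  rw [unitors_hid, unitors_inv_hid, runit_naturality' α hf, Iso.inv_hom_id_assoc]

lemma spComp_comp {x y z : X.Obj} (α β : X.Sq (X.hid x) (X.hid y)) (h : X.right α = X.left β)
    (γ δ : X.Sq (X.hid y) (X.hid z)) (h' : X.right γ = X.left δ) :
    spComp α β h ≫ spComp γ δ h' = spComp (α ≫ γ) (β ≫ δ) (by simp [h, h']) := by
  unfold spComp
  simp only [Category.assoc, Iso.hom_inv_id_assoc]
  rw [hsq_hsq_assoc]

lemma spComp_whisker {x y z : X.Obj} (α β : X.Sq (X.hid x) (X.hid y)) (h : X.right α = X.left β)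
    (f : y ⟶ z) :
    spComp α β h ≫ X.hidSq f = spComp (α ≫ X.hidSq f) (β ≫ X.hidSq f) (by simp [h]) := by
  rw [← spComp_comp α β h _ _ (by simp), hid_spComp _ (by simp)]

lemma whisker_spComp {x y z : X.Obj} (f : x ⟶ y) (α β : X.Sq (X.hid y) (X.hid z))
    (h : X.right α = X.left β) :
    X.hidSq f ≫ spComp α β h = spComp (X.hidSq f ≫ α) (X.hidSq f ≫ β) (by simp [h]) := by
  rw [← spComp_comp _ _ (by simp) α β h, hid_spComp _ (by simp)]

lemma spComp_assoc {x y : X.Obj} (α β γ : X.Sq (X.hid x) (X.hid y)) (h : X.right α = X.left β)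
    (h' : X.right β = X.left γ) :
    spComp (spComp α β h) γ (by simp [h']) = spComp α (spComp β γ h') (by simp [h]) := by
  have e₁ : X.hsq ((X.lunit _).inv ≫ X.hsq α β h ≫ (X.lunit _).hom) γ (by simp [h']) =
      X.hsq (X.lunit _).inv (X.one _) (by simp) ≫ X.hsq (X.hsq α β h) γ (by simp [h']) ≫
        X.hsq (X.lunit _).hom (X.one _) (by simp) := by
    rw [hsq_hsq, hsq_hsq]; exact hsq_congr _ rfl (by simp)
  have e₂ : X.hsq α ((X.lunit _).inv ≫ X.hsq β γ h' ≫ (X.lunit _).hom) (by simp [h]) =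
      X.hsq (X.one _) (X.lunit _).inv (by simp) ≫ X.hsq α (X.hsq β γ h') (by simp [h]) ≫
        X.hsq (X.one _) (X.lunit _).hom (by simp) := by
    rw [hsq_hsq, hsq_hsq]; exact hsq_congr _ (by simp) rfl
  have e₃ (z : X.Obj) : X.hsq (X.lunit (X.hid z)).hom (X.one (X.hid z)) (by simp) =
      (X.assoc _ _ _).hom ≫ X.hsq (X.one (X.hid z)) (X.lunit (X.hid z)).hom (by simp) := by
    rw [X.triangle]; exact hsq_congr _ (unitors_hid z) rfl
  have e₄ (z : X.Obj) : X.hsq (X.lunit (X.hid z)).inv (X.one (X.hid z)) (by simp) =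
      X.hsq (X.one (X.hid z)) (X.lunit (X.hid z)).inv (by simp) ≫ (X.assoc _ _ _).inv := by
    have hi := isIso_hsq (X.lunit (X.hid z)).hom (X.one (X.hid z)) (by simp)
    rw [← cancel_mono (X.hsq (X.lunit (X.hid z)).hom (X.one (X.hid z)) (by simp)), hsq_hsq, e₃,
      Category.assoc, Iso.inv_hom_id_assoc, hsq_hsq]
    exact (hsq_eq_one _ (by simp) (by simp)).trans (hsq_eq_one _ (by simp) (by simp)).symm
  unfold spComp
  rw [e₁, e₂, e₃, e₄]
  simp only [Category.assoc]
  rw [X.assoc_naturality_assoc α β γ h h', Iso.inv_hom_id_assoc]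

variable (X) in
/-- A quintet: a square of arrows with top `γ`, bottom `δ` and with left and right sides `α`, `β` in
the class `W`, together with a cell `γ ≫ β ⇛ α ≫ δ` between external identities. -/
@[ext]
structure Quintet (W : ∀ ⦃x y : X.Obj⦄, (x ⟶ y) → Prop) (x y x' y' : X.Obj) where
  top : x ⟶ y
  bot : x' ⟶ y'
  left : {f : x ⟶ x' // W f}
  right : {f : y ⟶ y' // W f}
  sq : X.Sq (X.hid x) (X.hid y')
  left_sq : X.left sq = top ≫ right.1
  right_sq : X.right sq = left.1 ≫ bot

attribute [simp] Quintet.left_sq Quintet.right_sq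

variable (X) in
/-- The strict double category of quintets with the same objects as `X`, whose arrows are the arrows
of `X` in the class `W`, and whose proarrows are all arrows of `X`. -/
def quintets (W : ∀ ⦃x y : X.Obj⦄, (x ⟶ y) → Prop) (hW : ∀ x, W (𝟙 x))
    (hW' : ∀ ⦃x y z : X.Obj⦄ (f : x ⟶ y) (g : y ⟶ z), W f → W g → W (f ≫ g)) :
    StrictDoubleCategory.{u, v, v, max v t} where
  Obj := X.Obj
  Arr x y := {f : x ⟶ y // W f}
  arrId x := ⟨𝟙 x, hW x⟩
  arrComp f g := ⟨f.1 ≫ g.1, hW' f.1 g.1 f.2 g.2⟩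
  arr_id_comp f := Subtype.ext (Category.id_comp f.1)
  arr_comp_id f := Subtype.ext (Category.comp_id f.1)
  arr_assoc f g h := Subtype.ext (Category.assoc f.1 g.1 h.1)
  Pro x y := x ⟶ y
  proId x := 𝟙 x
  proComp f g := f ≫ g
  pro_id_comp f := Category.id_comp f
  pro_comp_id f := Category.comp_id f
  pro_assoc f g h := Category.assoc f g h
  Sq x y x' y' := Quintet X W x y x' y'
  top α := α.top
  bot α := α.bot
  left α := α.left
  right α := α.right
  vid m := ⟨m, m, ⟨𝟙 _, hW _⟩, ⟨𝟙 _, hW _⟩, X.hidSq m, by simp, by simp⟩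
  top_vid _ := rfl
  bot_vid _ := rfl
  left_vid _ := rfl
  right_vid _ := rfl
  vcomp α β h :=
    { top := α.top
      bot := β.bot
      left := ⟨α.left.1 ≫ β.left.1, hW' _ _ α.left.2 β.left.2⟩
      right := ⟨α.right.1 ≫ β.right.1, hW' _ _ α.right.2 β.right.2⟩
      sq := spComp (α.sq ≫ X.hidSq β.right.1) (X.hidSq α.left.1 ≫ β.sq) (by simp [h])
      left_sq := by simp
      right_sq := by simp }
  top_vcomp _ _ _ := rfl
  bot_vcomp _ _ _ := rfl
  left_vcomp _ _ _ := rfl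
  right_vcomp _ _ _ := rfl
  hid f := ⟨𝟙 _, 𝟙 _, f, f, X.hidSq f.1, by simp, by simp⟩
  left_hid _ := rfl
  right_hid _ := rfl
  top_hid _ := rfl
  bot_hid _ := rfl
  hcomp α β h :=
    { top := α.top ≫ β.top
      bot := α.bot ≫ β.bot
      left := α.left
      right := β.right
      sq := spComp (X.hidSq α.top ≫ β.sq) (α.sq ≫ X.hidSq β.bot) (by simp [h])
      left_sq := by simp
      right_sq := by simp }
  left_hcomp _ _ _ := rfl
  right_hcomp _ _ _ := rfl
  top_hcomp _ _ _ := rfl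
  bot_hcomp _ _ _ := rfl
  vid_vcomp α := by
    ext1 <;> try rfl
    · exact Subtype.ext (Category.id_comp _)
    · exact Subtype.ext (Category.id_comp _)
    · refine Eq.trans (spComp_congr _ (X.hidSq_comp _ _).symm
        ((congrArg (· ≫ α.sq) (X.hidSq_id _)).trans (Category.id_comp _))) ?_
      exact hid_spComp _ α.left_sq
  vcomp_vid α := by
    ext1 <;> try rfl
    · exact Subtype.ext (Category.comp_id _)
    · exact Subtype.ext (Category.comp_id _)
    · refine Eq.trans (spComp_congr _
        ((congrArg (α.sq ≫ ·) (X.hidSq_id _)).trans (Category.comp_id _))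
        (X.hidSq_comp _ _).symm) ?_
      exact spComp_hid _ α.right_sq
  vcomp_assoc α β γ h k := by
    ext1 <;> try rfl
    · exact Subtype.ext (Category.assoc _ _ _)
    · exact Subtype.ext (Category.assoc _ _ _)
    · refine (spComp_congr _ (spComp_whisker _ _ _ _) rfl).trans ?_
      refine Eq.trans ?_ (spComp_congr _ rfl (whisker_spComp _ _ _ _)).symm
      refine Eq.trans (spComp_congr _ (spComp_congr _ ?_ ?_) ?_) (spComp_assoc _ _ _ ?_ ?_)
      all_goals simp [hidSq_comp, h, k]
  hid_hcomp α := by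
    ext1 <;> try rfl
    · exact Category.id_comp _
    · exact Category.id_comp _
    · refine Eq.trans (spComp_congr _
        ((congrArg (· ≫ α.sq) (X.hidSq_id _)).trans (Category.id_comp _))
        (X.hidSq_comp _ _).symm) ?_
      exact spComp_hid _ α.right_sq
  hcomp_hid α := by
    ext1 <;> try rfl
    · exact Category.comp_id _
    · exact Category.comp_id _
    · refine Eq.trans (spComp_congr _ (X.hidSq_comp _ _).symm
        ((congrArg (α.sq ≫ ·) (X.hidSq_id _)).trans (Category.comp_id _))) ?_
      exact hid_spComp _ α.left_sq
  hcomp_assoc α β γ h k := by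
    ext1 <;> try rfl
    · exact Category.assoc _ _ _
    · exact Category.assoc _ _ _
    · refine (spComp_congr _ rfl (spComp_whisker _ _ _ _)).trans ?_
      refine Eq.trans ?_ (spComp_congr _ (whisker_spComp _ _ _ _) rfl).symm
      refine Eq.trans (spComp_congr _ ?_ (spComp_congr _ ?_ ?_)) (spComp_assoc _ _ _ ?_ ?_).symm
      all_goals simp [hidSq_comp, h, k]
  vid_proId x := by
    ext1 <;> rfl
  vid_proComp f g := by
    ext1 <;> try rfl
    exact ((spComp_congr _ (X.hidSq_comp _ _).symm (X.hidSq_comp _ _).symm).trans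
      (hid_spComp _ (by simp))).symm
  hid_arrComp f g := by
    ext1 <;> try rfl
    exact ((spComp_congr _ (X.hidSq_comp _ _).symm (X.hidSq_comp _ _).symm).trans
      (hid_spComp _ (by simp))).symm
  interchange α β γ δ h h' k k' := by
    have a₁ : X.hidSq α.right.1 = X.hidSq β.left.1 := by rw [h]
    have a₂ : X.hidSq γ.right.1 = X.hidSq δ.left.1 := by rw [h']
    have a₃ : X.hidSq α.bot = X.hidSq γ.top := by rw [k]
    have a₄ : X.hidSq β.bot = X.hidSq δ.top := by rw [k']
    have m₁ : spComp (α.sq ≫ X.hidSq β.bot ≫ X.hidSq δ.right.1)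
        (X.hidSq α.left.1 ≫ X.hidSq γ.top ≫ δ.sq) (by simp [k, k']) = α.sq ≫ δ.sq := by
      have e := spComp_comp α.sq (X.hidSq (α.left.1 ≫ α.bot)) (by simp)
        (X.hidSq (δ.top ≫ δ.right.1)) δ.sq (by simp)
      rw [spComp_hid _ α.right_sq, hid_spComp _ δ.left_sq] at e
      rw [e]
      refine spComp_congr _ ?_ ?_
      · rw [a₄, hidSq_comp]
      · rw [← a₃, hidSq_comp, Category.assoc]
    have m₂ : spComp (X.hidSq α.top ≫ X.hidSq β.left.1 ≫ δ.sq)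
        (α.sq ≫ X.hidSq γ.right.1 ≫ X.hidSq δ.bot) (by simp [h, h']) = α.sq ≫ δ.sq := by
      have e := spComp_comp (X.hidSq (α.top ≫ α.right.1)) α.sq (by simp)
        δ.sq (X.hidSq (δ.left.1 ≫ δ.bot)) (by simp)
      rw [hid_spComp _ α.left_sq, spComp_hid _ δ.right_sq] at e
      rw [e]
      refine spComp_congr _ ?_ ?_
      · rw [← a₁, hidSq_comp, Category.assoc]
      · rw [a₂, hidSq_comp]
    have aux : ∀ {x y : X.Obj} (p q r s q' r' : X.Sq (X.hid x) (X.hid y))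
        (h₁ : X.right p = X.left q) (h₂ : X.right q = X.left r) (h₃ : X.right r = X.left s)
        (h₁' : X.right p = X.left q') (h₂' : X.right q' = X.left r')
        (h₃' : X.right r' = X.left s) (e : spComp q r h₂ = spComp q' r' h₂'),
        spComp (spComp p q h₁) (spComp r s h₃) (by simp [h₂]) =
          spComp (spComp p q' h₁') (spComp r' s h₃') (by simp [h₂']) := by
      intro x y p q r s q' r' h₁ h₂ h₃ h₁' h₂' h₃' e
      rw [spComp_assoc p q _ h₁ (by simp [h₂]), spComp_assoc p q' _ h₁' (by simp [h₂'])]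
      refine spComp_congr _ rfl ?_
      rw [← spComp_assoc q r s h₂ h₃, ← spComp_assoc q' r' s h₂' h₃']
      exact spComp_congr _ e rfl
    ext1 <;> try rfl
    refine (spComp_congr _ (spComp_whisker _ _ _ _) (whisker_spComp _ _ _ _)).trans ?_
    refine Eq.trans ?_ (spComp_congr _ (whisker_spComp _ _ _ _) (spComp_whisker _ _ _ _)).symm
    simp only [Category.assoc]
    exact aux _ _ _ _ _ _ _ _ _ _ _ _ (m₁.trans m₂.symm)

end quintets

/-- Natural transformations whose component arrows have companions. -/
def HasCompanionComponents {F G : LaxDoubleFunctor D E} (α : F ⟶ G) : Prop :=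
  ∀ x : D.Obj, Nonempty (Companion (LaxDoubleFunctor.NatTrans.app α x))

/-- Natural transformations whose component cells are commuters. -/
def HasCommuterComponents {F G : LaxDoubleFunctor D E} (α : F ⟶ G) : Prop :=
  ∀ ⦃x y : D.Obj⦄ (m : D.Pro x y), IsCommuter (LaxDoubleFunctor.NatTrans.sq α m)

lemma hasCompanionComponents_id (F : LaxDoubleFunctor D E) : HasCompanionComponents (𝟙 F) :=
  fun _ => ⟨Companion.id _⟩

lemma HasCompanionComponents.comp {F G H : LaxDoubleFunctor D E} {α : F ⟶ G} {β : G ⟶ H}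
    (h : HasCompanionComponents α) (h' : HasCompanionComponents β) :
    HasCompanionComponents (α ≫ β) :=
  fun x => ⟨(h x).some.comp (h' x).some⟩

lemma hasCommuterComponents_id (F : LaxDoubleFunctor D E) : HasCommuterComponents (𝟙 F) :=
  fun _ _ m => isCommuter_id (F.pro m)

lemma HasCommuterComponents.comp {F G H : LaxDoubleFunctor D E} {α : F ⟶ G} {β : G ⟶ H}
    (h : HasCommuterComponents α) (h' : HasCommuterComponents β) :
    HasCommuterComponents (α ≫ β) :=
  fun _ _ m => (h m).comp (h' m)

/-- The strict double category of lax double functors; its arrows are natural transformations whose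
component arrows have companions, its proarrows are natural transformations, and its cells are
modifications (bounded by identity protransformations) from the composite of the top and right sides
to the composite of the left and bottom sides. -/
def LaxComp (D : DoubleCategory.{u₁, v₁, w₁, t₁}) (E : DoubleCategory.{u₂, v₂, w₂, t₂}) :
    StrictDoubleCategory :=
  quintets (LaxOpl D E)
    (fun (F G : LaxDoubleFunctor D E) (α : F ⟶ G) => HasCompanionComponents α)
    hasCompanionComponents_id
    (fun (_ _ _ : LaxDoubleFunctor D E) _ _ h h' => h.comp h')

/-- The variant of `LaxComp D E` whose arrows are natural transformations whose component arrows have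
companions and whose component cells are commuters. -/
def LaxCC (D : DoubleCategory.{u₁, v₁, w₁, t₁}) (E : DoubleCategory.{u₂, v₂, w₂, t₂}) :
    StrictDoubleCategory :=
  quintets (LaxOpl D E)
    (fun (F G : LaxDoubleFunctor D E) (α : F ⟶ G) =>
      HasCompanionComponents α ∧ HasCommuterComponents α)
    (fun F => ⟨hasCompanionComponents_id F, hasCommuterComponents_id F⟩)
    (fun (_ _ _ : LaxDoubleFunctor D E) _ _ h h' => ⟨h.1.comp h'.1, h.2.comp h'.2⟩)

/-- The functor that is the identity on lax double functors and natural transformations. -/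
def LaxComp.idFunctor (D : DoubleCategory.{u₁, v₁, w₁, t₁}) (E : DoubleCategory.{u₂, v₂, w₂, t₂}) :
    (LaxComp D E).transpose.toDouble.Obj ⥤ (LaxOpl D E).Obj where
  obj F := F
  map α := α
  map_id _ := rfl
  map_comp _ _ := rfl

/-- The functor that is the identity on lax double functors and natural transformations. -/
def LaxCC.idFunctor (D : DoubleCategory.{u₁, v₁, w₁, t₁}) (E : DoubleCategory.{u₂, v₂, w₂, t₂}) :
    (LaxCC D E).transpose.toDouble.Obj ⥤ (LaxPs D E).Obj where
  obj F := F
  map α := α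
  map_id _ := rfl
  map_comp _ _ := rfl

end DoubleCategory

/-!
A cell `f_! → f'_!` between companions with sides `a` and `b` is the same thing as a cell
`a ≫ f' ⇛ f ≫ b`, by pasting with the unit of `f_!` and the counit of `f'_!`. Hence any choice of
companions turns quintets into cells and is a double functor from the transpose of the double
category of quintets: its comparison cells are the unique globular cells between companions that
respect the units, and the coherence laws hold by this uniqueness.

It remains to find companions in `LaxOpl D E`. For a natural transformation `α` whose components
have companions, these companions are the components of a protransformation whose comparison
cells are the slides `m ⊙ g_! → f_! ⊙ n` of the component cells of `α`, and their units and counits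
form modifications. The slides are invertible exactly when the component cells are commuters, and
then the companion of `α` lies in `LaxPs D E`.
-/

namespace DoubleCategory

section Companions

variable {X : DoubleCategory.{u, v, w, t}}

namespace Companion

section UniversalProperties

variable {x y z w : X.Obj} {f : x ⟶ y} (c : Companion f)

-- The triangle identity is inserted between `φ` and `ψ`; naturality of the unitors then moves `φ`
-- and `ψ` inside the external composite. Both universal properties of `f_!` follow from this.
lemma comp_eq_hsq {n : X.Pro z w} {z' w' : X.Obj} {p : X.Pro z' w'} (φ : X.Sq n c.pro)
    (ψ : X.Sq c.pro p) :
    φ ≫ ψ = (X.lunit n).inv ≫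
      X.hsq (X.hidSq (X.left φ) ≫ c.unit ≫ ψ) ((φ ≫ c.counit) ≫ X.hidSq (X.right ψ)) (by simp) ≫
        (X.runit p).hom := by
  have triangle : φ ≫ ψ = φ ≫ ((X.lunit c.pro).inv ≫ X.hsq c.unit c.counit (by simp) ≫
      (X.runit c.pro).hom) ≫ ψ := by
    rw [c.hsq_unit_counit]
    exact congrArg (φ ≫ ·) (Category.id_comp ψ).symm
  rw [triangle]
  simp only [Category.assoc]
  rw [lunit_inv_naturality_assoc, ← X.runit_naturality ψ, hsq_hsq_assoc, hsq_hsq_assoc]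
  exact congrArg (_ ≫ · ≫ _) (hsq_congr _ (Category.assoc _ _ _) (Category.assoc _ _ _))

lemma hom_ext_unit {n : X.Pro z w} {β β' : X.Sq c.pro n} (hr : X.right β = X.right β')
    (h : c.unit ≫ β = c.unit ≫ β') : β = β' := by
  rw [← Category.id_comp β, ← Category.id_comp β']
  refine (c.comp_eq_hsq (X.one _) β).trans (.trans ?_ (c.comp_eq_hsq (X.one _) β').symm)
  simp only [h, hr]

lemma hom_ext_counit {n : X.Pro z w} {β β' : X.Sq n c.pro} (hl : X.left β = X.left β')
    (h : β ≫ c.counit = β' ≫ c.counit) : β = β' := by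
  rw [← Category.comp_id β, ← Category.comp_id β']
  refine (c.comp_eq_hsq β (X.one _)).trans (.trans ?_ (c.comp_eq_hsq β' (X.one _)).symm)
  simp only [h, hl]

/-- The cell out of `f_!` induced by a cell out of `hid x` whose right side factors through `f`. -/
def desc {n : X.Pro z w} (φ : X.Sq (X.hid x) n) (b : y ⟶ w) (hr : X.right φ = f ≫ b) :
    X.Sq c.pro n :=
  (X.lunit c.pro).inv ≫ X.hsq φ (c.counit ≫ X.hidSq b) (by simp [hr]) ≫ (X.runit n).hom

/-- The cell into `f_!` induced by a cell into `hid y` whose left side factors through `f`. -/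
def lift {n : X.Pro z w} (φ : X.Sq n (X.hid y)) (a : z ⟶ x) (hl : X.left φ = a ≫ f) :
    X.Sq n c.pro :=
  (X.lunit n).inv ≫ X.hsq (X.hidSq a ≫ c.unit) φ (by simp [hl]) ≫ (X.runit c.pro).hom

section

variable {n : X.Pro z w} (φ : X.Sq (X.hid x) n) {b : y ⟶ w} (hr : X.right φ = f ≫ b)

@[simp] lemma left_desc : X.left (c.desc φ b hr) = X.left φ := by simp [desc]

@[simp] lemma right_desc : X.right (c.desc φ b hr) = b := by simp [desc]

lemma unit_desc : c.unit ≫ c.desc φ b hr = φ := by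
  have unit_counit_comp : c.unit ≫ c.counit ≫ X.hidSq b = X.hidSq (f ≫ b) := by
    rw [← Category.assoc, c.unit_counit, hidSq_comp]
  have hid_comp : X.hidSq (X.left c.unit) ≫ φ = φ := by
    rw [c.left_unit, hidSq_id, Category.id_comp]
  unfold desc
  rw [lunit_inv_naturality_assoc, hsq_hsq_assoc, hsq_congr _ hid_comp unit_counit_comp,
    runit_naturality' φ hr, unitors_inv_hid, Iso.inv_hom_id_assoc]

end

section

variable {n : X.Pro z w} (φ : X.Sq n (X.hid y)) {a : z ⟶ x} (hl : X.left φ = a ≫ f)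

@[simp] lemma left_lift : X.left (c.lift φ a hl) = a := by simp [lift]

@[simp] lemma right_lift : X.right (c.lift φ a hl) = X.right φ := by simp [lift]

lemma lift_counit : c.lift φ a hl ≫ c.counit = φ := by
  have comp_unit_counit : (X.hidSq a ≫ c.unit) ≫ c.counit = X.hidSq (a ≫ f) := by
    rw [Category.assoc, c.unit_counit, hidSq_comp]
  have comp_hid : φ ≫ X.hidSq (X.right c.counit) = φ := by
    rw [c.right_counit, hidSq_id, Category.comp_id]
  unfold lift
  simp only [Category.assoc]
  rw [← X.runit_naturality c.counit, hsq_hsq_assoc, hsq_congr _ comp_unit_counit comp_hid,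
    ← unitors_hid, lunit_naturality' φ hl, Iso.inv_hom_id_assoc]

end

end UniversalProperties

section Mates

variable {x y x' y' x'' y'' : X.Obj} {f : x ⟶ y} {f' : x' ⟶ y'} {f'' : x'' ⟶ y''}
  (c : Companion f) (c' : Companion f') (c'' : Companion f'')

lemma hom_ext {β β' : X.Sq c.pro c'.pro} (hl : X.left β = X.left β')
    (hr : X.right β = X.right β') (h : c.unit ≫ β ≫ c'.counit = c.unit ≫ β' ≫ c'.counit) :
    β = β' :=
  c.hom_ext_unit hr (c'.hom_ext_counit (by simp [hl]) (by simpa using h))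

/-- The cell `f_! → f'_!` corresponding to a cell between external identities with left side
`a ≫ f'` and right side `f ≫ b`, that is, to a cell `a ≫ f' ⇛ f ≫ b` filling a square of arrows. -/
def mate {a : x ⟶ x'} {b : y ⟶ y'} (θ : X.Sq (X.hid x) (X.hid y')) (hl : X.left θ = a ≫ f')
    (hr : X.right θ = f ≫ b) : X.Sq c.pro c'.pro :=
  c.desc (c'.lift θ a hl) b (by simp [hr])

/-- The cell `f_! → f'_!` induced by a commutative square of arrows. -/
def map {a : x ⟶ x'} {b : y ⟶ y'} (e : a ≫ f' = f ≫ b) : X.Sq c.pro c'.pro :=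
  c.desc (X.hidSq a ≫ c'.unit) b (by simp [e])

section

variable {a : x ⟶ x'} {b : y ⟶ y'} {θ : X.Sq (X.hid x) (X.hid y')} (hl : X.left θ = a ≫ f')
  (hr : X.right θ = f ≫ b)

@[simp] lemma left_mate : X.left (c.mate c' θ hl hr) = a := by simp [mate]

@[simp] lemma right_mate : X.right (c.mate c' θ hl hr) = b := by simp [mate]

lemma unit_mate_counit : c.unit ≫ c.mate c' θ hl hr ≫ c'.counit = θ := by
  rw [← Category.assoc, mate, unit_desc, lift_counit]

lemma eq_mate {β : X.Sq c.pro c'.pro} (ha : X.left β = a) (hb : X.right β = b)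
    (h : c.unit ≫ β ≫ c'.counit = θ) : β = c.mate c' θ hl hr :=
  c.hom_ext c' (by simp [ha]) (by simp [hb]) (by rw [h, unit_mate_counit])

lemma mate_comp {a' : x' ⟶ x''} {b' : y' ⟶ y''} {θ' : X.Sq (X.hid x') (X.hid y'')}
    (hl' : X.left θ' = a' ≫ f'') (hr' : X.right θ' = f' ≫ b') :
    c.mate c' θ hl hr ≫ c'.mate c'' θ' hl' hr' =
      c.mate c'' (a := a ≫ a') (b := b ≫ b')
        (spComp (X.hidSq a ≫ θ') (θ ≫ X.hidSq b') (by simp [hr', hl])) (by simp [hl'])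
        (by simp [hr]) := by
  refine c.eq_mate c'' _ _ (by simp) (by simp) ?_
  have factor := c'.comp_eq_hsq (c.unit ≫ c.mate c' θ hl hr) (c'.mate c'' θ' hl' hr' ≫ c''.counit)
  simp only [Category.assoc] at factor ⊢
  rw [factor, spComp, unitors_hid]
  refine congrArg (_ ≫ · ≫ _) (hsq_congr _ ?_ ?_)
  · rw [unit_mate_counit, left_comp, c.left_unit, left_mate, Category.id_comp]
  · rw [← Category.assoc, ← Category.assoc, Category.assoc c.unit, unit_mate_counit, right_comp,
      right_mate, c''.right_counit, Category.comp_id]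

end

section

variable {a : x ⟶ x'} {b : y ⟶ y'} (e : a ≫ f' = f ≫ b)

@[simp] lemma left_map : X.left (c.map c' e) = a := by simp [map]

@[simp] lemma right_map : X.right (c.map c' e) = b := by simp [map]

lemma unit_map : c.unit ≫ c.map c' e = X.hidSq a ≫ c'.unit := c.unit_desc _ _

lemma map_counit : c.map c' e ≫ c'.counit = c.counit ≫ X.hidSq b := by
  refine c.hom_ext_unit (by simp) ?_
  rw [← Category.assoc, unit_map, Category.assoc, c'.unit_counit, ← Category.assoc, c.unit_counit,
    ← hidSq_comp, ← hidSq_comp, e]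

end

lemma mate_id (f : x ⟶ y) :
    (Companion.id x).mate (Companion.id y) (a := f) (b := f) (X.hidSq f) (by simp) (by simp) =
      X.hidSq f :=
  ((Companion.id x).eq_mate (Companion.id y) _ _ (X.left_hidSq f) (X.right_hidSq f)
    ((Category.id_comp _).trans (Category.comp_id _))).symm

lemma comp_counit {z : X.Obj} {g : y ⟶ z} (d : Companion g) :
    (c.comp d).counit =
      X.hsq (c.counit ≫ X.hidSq g) d.counit (by simp) ≫ (X.lunit (X.hid z)).hom := by
  change X.hsq c.counit (X.one d.pro) _ ≫ (X.lunit d.pro).hom ≫ d.counit = _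
  rw [← lunit_naturality' d.counit d.left_counit, hsq_hsq_assoc]
  exact congrArg (· ≫ _) (hsq_congr _ rfl (Category.id_comp _))

lemma hsq_mate {z z' : X.Obj} {g : y ⟶ z} {g' : y' ⟶ z'} (d : Companion g) (d' : Companion g')
    {a : x ⟶ x'} {b : y ⟶ y'} {k : z ⟶ z'} {θ : X.Sq (X.hid x) (X.hid y')}
    {θ' : X.Sq (X.hid y) (X.hid z')} (hl : X.left θ = a ≫ f') (hr : X.right θ = f ≫ b)
    (hl' : X.left θ' = b ≫ g') (hr' : X.right θ' = g ≫ k) :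
    X.hsq (c.mate c' θ hl hr) (d.mate d' θ' hl' hr') (by simp) =
      (c.comp d).mate (c'.comp d') (a := a) (b := k)
        (spComp (θ ≫ X.hidSq g') (X.hidSq f ≫ θ') (by simp [hr, hl'])) (by simp [hl])
        (by simp [hr']) := by
  refine eq_mate (c.comp d) (c'.comp d') _ _ ((X.left_hsq _ _ _).trans (by simp))
    ((X.right_hsq _ _ _).trans (by simp)) ?_
  rw [comp_unit, comp_counit]
  refine (Category.assoc _ _ _).trans (congrArg (_ ≫ ·) ?_)
  refine (hsq_hsq_assoc _ _ _ _ _ _ _).trans ((hsq_hsq_assoc _ _ _ _ _ _ _).trans ?_)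
  refine congrArg (· ≫ _) (hsq_congr _ ?_ ?_)
  · simpa only [Category.assoc] using
      congrArg (· ≫ X.hidSq g') (c.unit_mate_counit c' hl hr)
  · simpa only [Category.assoc] using
      congrArg (X.hidSq f ≫ ·) (d.unit_mate_counit d' hl' hr')

end Mates

end Companion

/-- `χ : f_! → f'_!` is a globular cell respecting the units. For any two choices of companion of an
arrow there is exactly one; stating this for propositionally equal `f` and `f'` avoids transporting
companions along equalities of arrows. -/
structure Companion.IsComparison {x y : X.Obj} {f f' : x ⟶ y} (c : Companion f)
    (c' : Companion f') (χ : X.Sq c.pro c'.pro) : Prop where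
  left : X.left χ = 𝟙 x
  right : X.right χ = 𝟙 y
  unit : c.unit ≫ χ = c'.unit

/-- The canonical cell between two companions of an arrow. -/
def Companion.comparison {x y : X.Obj} {f f' : x ⟶ y} (c : Companion f) (c' : Companion f')
    (e : f = f') : X.Sq c.pro c'.pro :=
  c.map c' (a := 𝟙 x) (b := 𝟙 y) (by simp [e])

namespace Companion.IsComparison

variable {x y z w : X.Obj} {f f' f'' : x ⟶ y} {c : Companion f} {c' : Companion f'}
  {c'' : Companion f''}

lemma unique {χ χ' : X.Sq c.pro c'.pro} (h : c.IsComparison c' χ) (h' : c.IsComparison c' χ') :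
    χ = χ' :=
  c.hom_ext_unit (h.right.trans h'.right.symm) (h.unit.trans h'.unit.symm)

lemma arrow_eq {χ : X.Sq c.pro c'.pro} (h : c.IsComparison c' χ) : f = f' := by
  simpa [h.right] using congrArg X.right h.unit

lemma one : c.IsComparison c (X.one c.pro) := ⟨by simp, by simp, by simp⟩

lemma comp {χ : X.Sq c.pro c'.pro} {χ' : X.Sq c'.pro c''.pro} (h : c.IsComparison c' χ)
    (h' : c'.IsComparison c'' χ') : c.IsComparison c'' (χ ≫ χ') :=
  ⟨by simp [h.left, h'.left], by simp [h.right, h'.right],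
    by rw [← Category.assoc, h.unit, h'.unit]⟩

lemma counit {χ : X.Sq c.pro c'.pro} (h : c.IsComparison c' χ) : χ ≫ c'.counit = c.counit := by
  refine c.hom_ext_unit (by simp [h.right]) ?_
  rw [← Category.assoc, h.unit, c'.unit_counit, c.unit_counit, h.arrow_eq]

lemma of_comparison (c : Companion f) (c' : Companion f') (e : f = f') :
    c.IsComparison c' (c.comparison c' e) :=
  ⟨left_map _ _ _, right_map _ _ _, by simp [comparison, unit_map]⟩

lemma isIso {χ : X.Sq c.pro c'.pro} (h : c.IsComparison c' χ) : IsIso χ := by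
  have inverse := of_comparison c' c h.arrow_eq.symm
  exact ⟨_, (h.comp inverse).unique one, (inverse.comp h).unique one⟩

lemma hsq {g g' : y ⟶ z} {d : Companion g} {d' : Companion g'} {χ : X.Sq c.pro c'.pro}
    {χ' : X.Sq d.pro d'.pro} (h : c.IsComparison c' χ) (h' : d.IsComparison d' χ') :
    (c.comp d).IsComparison (c'.comp d') (X.hsq χ χ' (by rw [h.right, h'.left])) := by
  refine ⟨(X.left_hsq _ _ _).trans h.left, (X.right_hsq _ _ _).trans h'.right, ?_⟩
  rw [comp_unit, comp_unit]
  refine (Category.assoc _ _ _).trans (congrArg (_ ≫ ·) ((hsq_hsq _ _ _ _ _ _).trans ?_))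
  refine hsq_congr _ h.unit ?_
  rw [Category.assoc, h'.unit, h.arrow_eq]

lemma lunit (c : Companion f) : ((Companion.id x).comp c).IsComparison c (X.lunit c.pro).hom := by
  refine ⟨X.left_lunit _, X.right_lunit _, ?_⟩
  have unit_naturality := lunit_naturality' (X.hidSq (𝟙 x) ≫ c.unit) (f := 𝟙 x) (by simp)
  rw [hsq_congr _ (X.hidSq_id x) rfl] at unit_naturality
  rw [comp_unit]
  refine (Category.assoc _ _ _).trans ((congrArg (_ ≫ ·) unit_naturality).trans ?_)
  rw [Iso.inv_hom_id_assoc, hidSq_id, Category.id_comp]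

lemma runit (c : Companion f) : (c.comp (Companion.id y)).IsComparison c (X.runit c.pro).hom := by
  refine ⟨X.left_runit _, X.right_runit _, ?_⟩
  change (c.unit ≫ (X.runit c.pro).inv ≫ X.hsq (X.one c.pro) (X.one _) _) ≫ _ = _
  rw [hsq_one]
  simp

end Companion.IsComparison

lemma runit_inv_comp_assoc_hom {x y z : X.Obj} (m : X.Pro x y) (n : X.Pro y z) :
    (X.runit (X.hcomp m n)).inv ≫ (X.assoc m n (X.hid z)).hom =
      X.hsq (X.one m) (X.runit n).inv (by simp) := by
  have whisker_inv : X.hsq (X.one m) (X.runit n).inv (by simp) ≫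
      X.hsq (X.one m) (X.runit n).hom (by simp) = 𝟙 _ := by
    rw [hsq_hsq]
    exact hsq_eq_one _ (Category.comp_id _) (X.runit n).inv_hom_id
  have := isIso_hsq (X.one m) (X.runit n).hom (by simp)
  rw [Iso.inv_comp_eq, ← cancel_mono (X.hsq (X.one m) (X.runit n).hom (by simp)),
    Category.assoc, whisker_inv, Category.comp_id, ← runit_hcomp, Iso.hom_inv_id_assoc]

lemma hsq_one_comp_assoc_hom {x y z w w' : X.Obj} (m : X.Pro x y) (n : X.Pro y z)
    {p : X.Pro z w} {p' : X.Pro z w'} (α : X.Sq p p') (h : X.left α = 𝟙 z) :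
    X.hsq (X.one (X.hcomp m n)) α (by simp [h]) ≫ (X.assoc m n p').hom =
      (X.assoc m n p).hom ≫ X.hsq (X.one m) (X.hsq (X.one n) α (by simp [h])) (by simp) := by
  rw [← X.assoc_naturality _ _ _ (by simp) (by simp [h])]
  exact congrArg (· ≫ _) (hsq_congr _ (X.hsq_one _ _).symm rfl)

lemma Companion.IsComparison.assoc {x y z w : X.Obj} {f : x ⟶ y} {g : y ⟶ z} {k : z ⟶ w}
    (c : Companion f) (d : Companion g) (e : Companion k) :
    ((c.comp d).comp e).IsComparison (c.comp (d.comp e)) (X.assoc c.pro d.pro e.pro).hom := by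
  refine ⟨X.left_assoc _ _ _, X.right_assoc _ _ _, ?_⟩
  change ((c.unit ≫ (X.runit c.pro).inv ≫ X.hsq (X.one c.pro) d.unit _) ≫
      (X.runit (X.hcomp c.pro d.pro)).inv ≫ X.hsq (X.one (X.hcomp c.pro d.pro)) e.unit _) ≫ _ =
    c.unit ≫ (X.runit c.pro).inv ≫ X.hsq (X.one c.pro)
      (d.unit ≫ (X.runit d.pro).inv ≫ X.hsq (X.one d.pro) e.unit _) _
  simp only [Category.assoc]
  rw [hsq_one_comp_assoc_hom _ _ _ e.left_unit,
    reassoc_of% runit_inv_comp_assoc_hom c.pro d.pro, hsq_hsq, hsq_hsq]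
  exact congrArg (_ ≫ _ ≫ ·) (hsq_congr _ (by simp) rfl)

lemma Companion.mate_comparison {x y x' y' : X.Obj} {f : x ⟶ y} {f' : x' ⟶ y'} (c d : Companion f)
    (c' d' : Companion f') {a : x ⟶ x'} {b : y ⟶ y'} {θ : X.Sq (X.hid x) (X.hid y')}
    (hl : X.left θ = a ≫ f') (hr : X.right θ = f ≫ b) :
    c.mate c' θ hl hr ≫ c'.comparison d' rfl = c.comparison d rfl ≫ d.mate d' θ hl hr := by
  have h := IsComparison.of_comparison c d rfl
  have h' := IsComparison.of_comparison c' d' rfl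
  refine c.hom_ext d' (by simp [h.left, h'.left]) (by simp [h.right, h'.right]) ?_
  rw [Category.assoc, h'.counit, unit_mate_counit, Category.assoc, ← Category.assoc, h.unit,
    unit_mate_counit]

end Companions

section Quintets

variable {X : DoubleCategory.{u, v, w, t}} {W : ∀ ⦃x y : X.Obj⦄, (x ⟶ y) → Prop}

namespace Quintet

/-- The cell between companions corresponding to a quintet: its mate, with the top and the bottom
of the quintet as the left and the right side. -/
def toSq {x y x' y' : X.Obj} (q : Quintet X W x y x' y') {f : {f : x ⟶ x' // W f}}
    {g : {g : y ⟶ y' // W g}} (hf : q.left = f) (hg : q.right = g) (cf : Companion f.1)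
    (cg : Companion g.1) : X.Sq cf.pro cg.pro :=
  cf.mate cg (a := q.top) (b := q.bot) q.sq (by simp [hg]) (by simp [hf])

lemma isComparison_toSq {x y : X.Obj} (q : Quintet X W x x y y) {f g : {f : x ⟶ y // W f}}
    (hf : q.left = f) (hg : q.right = g) (cf : Companion f.1) (cg : Companion g.1)
    (ht : q.top = 𝟙 x) (hb : q.bot = 𝟙 y) (hs : q.sq = X.hidSq f.1) :
    cf.IsComparison cg (q.toSq hf hg cf cg) := by
  refine ⟨(cf.left_mate _ _ _).trans ht, (cf.right_mate _ _ _).trans hb,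
    cg.hom_ext_counit (by simp [toSq, ht]) ?_⟩
  have left_eq_right : f.1 = g.1 := by simpa [ht, hs, hg] using q.left_sq
  rw [Category.assoc, toSq, Companion.unit_mate_counit, cg.unit_counit, hs,
    left_eq_right]

variable {hW : ∀ x, W (𝟙 x)}
  {hW' : ∀ ⦃x y z : X.Obj⦄ (f : x ⟶ y) (g : y ⟶ z), W f → W g → W (f ≫ g)}

lemma toSq_hcomp {x y z x' y' z' : X.Obj} (α : Quintet X W x y x' y') (β : Quintet X W y z y' z')
    {f : {f : x ⟶ x' // W f}} {g : {g : y ⟶ y' // W g}} {k : {k : z ⟶ z' // W k}}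
    (hf : α.left = f) (hg : α.right = g) (hg' : β.left = g) (hk : β.right = k)
    (cf : Companion f.1) (cg : Companion g.1) (ck : Companion k.1) (h : α.right = β.left) :
    toSq ((quintets X W hW hW').hcomp α β h) hf hk cf ck =
      α.toSq hf hg cf cg ≫ β.toSq hg' hk cg ck :=
  (Companion.mate_comp _ _ _ _ _ _ _).symm

lemma toSq_vcomp {x y x' y' x'' y'' : X.Obj} (α : Quintet X W x y x' y')
    (β : Quintet X W x' y' x'' y'') {f : {f : x ⟶ x' // W f}} {g : {g : y ⟶ y' // W g}}
    {f' : {f : x' ⟶ x'' // W f}} {g' : {g : y' ⟶ y'' // W g}}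
    (hf : α.left = f) (hg : α.right = g) (hf' : β.left = f') (hg' : β.right = g')
    (cf : Companion f.1) (cg : Companion g.1) (cf' : Companion f'.1) (cg' : Companion g'.1)
    (h : α.bot = β.top) (d : Companion (f.1 ≫ f'.1)) (d' : Companion (g.1 ≫ g'.1)) :
    X.hsq (α.toSq hf hg cf cg) (β.toSq hf' hg' cf' cg') (by simp [toSq, h]) ≫
        (cg.comp cg').comparison d' rfl =
      (cf.comp cf').comparison d rfl ≫
        toSq (f := ⟨_, hW' _ _ f.2 f'.2⟩) (g := ⟨_, hW' _ _ g.2 g'.2⟩)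
          ((quintets X W hW hW').vcomp α β h) (by subst hf hf'; rfl) (by subst hg hg'; rfl)
          d d' := by
  obtain ⟨top, bot, left, right, sq, hl, hr⟩ := α
  obtain ⟨top', bot', left', right', sq', hl', hr'⟩ := β
  dsimp only at hf hg hf' hg' h
  subst hf hg hf' hg' h
  refine (congrArg (· ≫ _) (Companion.hsq_mate cf cg cf' cg' hl hr hl' hr')).trans ?_
  exact Companion.mate_comparison _ _ _ _ _ _

end Quintet

variable (hW : ∀ x, W (𝟙 x))
  (hW' : ∀ ⦃x y z : X.Obj⦄ (f : x ⟶ y) (g : y ⟶ z), W f → W g → W (f ≫ g))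
  (c : ∀ ⦃x y : X.Obj⦄ (f : {f : x ⟶ y // W f}), Companion f.1)

open Quintet Companion in
/-- The double functor out of the transposed quintets given by a choice of companions of the
arrows in `W`. -/
def quintetFunctor : DoubleFunctor (quintets X W hW hW').transpose.toDouble X where
  obj x := x
  map f := f
  map_id _ := rfl
  map_comp _ _ := rfl
  pro f := (c (x := _) (y := _) f).pro
  sq {_ _ _ _ m n} α := toSq (X := X) (W := W) α.1 α.2.1 α.2.2 (c m) (c n)
  left_sq _ := left_mate _ _ _ _
  right_sq _ := right_mate _ _ _ _
  sq_one _ := (isComparison_toSq (X := X) _ _ _ _ _ rfl rfl rfl).unique .one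
  sq_comp {_ _ _ _ _ _ m n p} α β :=
    toSq_hcomp (hW := hW) (hW' := hW') α.1 β.1 α.2.1 α.2.2 β.2.1 β.2.2 (c m) (c n) (c p)
      (α.2.2.trans β.2.1.symm)
  lax m n := ((c m).comp (c n)).comparison (c ⟨m.1 ≫ n.1, hW' _ _ m.2 n.2⟩) rfl
  left_lax _ _ := (IsComparison.of_comparison _ _ _).left
  right_lax _ _ := (IsComparison.of_comparison _ _ _).right
  unit x := (Companion.id (X := X) x).comparison (c ⟨𝟙 (show X.Obj from x), hW x⟩) rfl
  left_unit _ := (IsComparison.of_comparison _ _ _).left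
  right_unit _ := (IsComparison.of_comparison _ _ _).right
  lax_naturality {_ _ _ _ _ _ m n m' n'} α β h :=
    toSq_vcomp (hW := hW) (hW' := hW') α.1 β.1 α.2.1 α.2.2 β.2.1 β.2.2 (c m) (c m') (c n)
      (c n') h _ _
  unit_naturality f :=
    (congrArg (· ≫ _) (mate_id (X := X) f).symm).trans (mate_comparison (X := X) _ _ _ _ _ _)
  lax_assoc m n p := IsComparison.unique
    ((IsComparison.hsq (.of_comparison _ _ _) .one).comp ((IsComparison.of_comparison _ _ _).comp
      (isComparison_toSq (X := X) (W := W) _ _ _ _ (c _) rfl rfl rfl)))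
    ((IsComparison.assoc (c m) (c n) (c p)).comp
      ((IsComparison.hsq .one (.of_comparison _ _ _)).comp (.of_comparison _ _ _)))
  lax_lunit m := IsComparison.unique
    ((IsComparison.hsq (.of_comparison _ _ _) .one).comp ((IsComparison.of_comparison _ _ _).comp
      (isComparison_toSq (X := X) (W := W) _ _ _ _ (c _) rfl rfl rfl)))
    (IsComparison.lunit (c m))
  lax_runit m := IsComparison.unique
    ((IsComparison.hsq .one (.of_comparison _ _ _)).comp ((IsComparison.of_comparison _ _ _).comp
      (isComparison_toSq (X := X) (W := W) _ _ _ _ (c _) rfl rfl rfl)))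
    (IsComparison.runit (c m))
  isIso_lax _ _ := (IsComparison.of_comparison _ _ _).isIso
  isIso_unit _ := (IsComparison.of_comparison _ _ _).isIso

end Quintets

section Slides

variable {X : DoubleCategory.{u, v, w, t}}

lemma hsq_comp_right {x y z x' y' z' : X.Obj} {m : X.Pro x y} {n n' : X.Pro y z}
    {m' : X.Pro x' y'} {p : X.Pro y' z'} (α : X.Sq m m') (θ : X.Sq n n') (β : X.Sq n' p)
    (hθ : X.left θ = 𝟙 y) (h : X.right α = X.left β) :
    X.hsq α (θ ≫ β) (by simp [hθ, h]) = X.hsq (X.one m) θ (by simp [hθ]) ≫ X.hsq α β h := by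
  rw [hsq_hsq]
  exact hsq_congr _ (Category.id_comp _).symm rfl

lemma hsq_comp_left {x y z x' y' z' : X.Obj} {m n : X.Pro x y} {p : X.Pro y z}
    {m' : X.Pro x' y'} {p' : X.Pro y' z'} (θ : X.Sq m n) (α : X.Sq n m') (β : X.Sq p p')
    (hθ : X.right θ = 𝟙 y) (h : X.right α = X.left β) :
    X.hsq (θ ≫ α) β (by simp [hθ, h]) = X.hsq θ (X.one p) (by simp [hθ]) ≫ X.hsq α β h := by
  rw [hsq_hsq]
  exact hsq_congr _ rfl (Category.id_comp _).symm

lemma Companion.hcomp_hom_eq_hsq {x y z : X.Obj} {m : X.Pro x y} {f : y ⟶ z} (c : Companion f)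
    {x' z' : X.Obj} {n : X.Pro x' z'} (γ : X.Sq (X.hcomp m c.pro) n) :
    γ = X.hsq (X.one m) (X.lunit c.pro).inv (by simp) ≫ (X.assoc _ _ _).inv ≫
      X.hsq (X.hsq (X.one m) c.unit (by simp) ≫ γ) (c.counit ≫ X.hidSq (X.right γ)) (by simp) ≫
        (X.runit n).hom := by
  have whiskered_triangle : X.hsq (X.one m) (X.lunit c.pro).inv (by simp) ≫
      X.hsq (X.one m) (X.hsq c.unit c.counit (by simp)) (by simp) ≫
      X.hsq (X.one m) (X.runit c.pro).hom (by simp) = 𝟙 _ := by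
    rw [hsq_hsq, hsq_hsq]
    exact hsq_eq_one _ (by simp) c.hsq_unit_counit
  rw [X.hsq_comp _ _ (by simp) _ _ (by simp), Category.assoc, X.runit_naturality γ,
    ← assoc_inv_naturality_assoc _ _ _ (by simp) (by simp),
    ← Category.assoc (X.assoc _ _ _).inv, runit_hcomp, ← Category.assoc, ← Category.assoc,
    Category.assoc (X.hsq _ _ _), whiskered_triangle, Category.id_comp]

lemma Companion.hcomp_hom_ext {x y z : X.Obj} {m : X.Pro x y} {f : y ⟶ z} (c : Companion f)
    {x' z' : X.Obj} {n : X.Pro x' z'} {β β' : X.Sq (X.hcomp m c.pro) n}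
    (hr : X.right β = X.right β')
    (h : X.hsq (X.one m) c.unit (by simp) ≫ β = X.hsq (X.one m) c.unit (by simp) ≫ β') :
    β = β' := by
  rw [c.hcomp_hom_eq_hsq β, c.hcomp_hom_eq_hsq β']
  simp only [h, hr]

section

variable {x y x' y' : X.Obj} {m : X.Pro x y} {n : X.Pro x' y'} {f : x ⟶ x'} {g : y ⟶ y'}
  (cf : Companion f) (cg : Companion g) (α : X.Sq m n) (hf : X.left α = f) (hg : X.right α = g)

@[simp] lemma left_slide : X.left (slide cf cg α hf hg) = 𝟙 x := by simp [slide]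

@[simp] lemma right_slide : X.right (slide cf cg α hf hg) = 𝟙 y' := by simp [slide]

lemma hsq_unit_slide {z z' : X.Obj} {p : X.Pro z z'} {a : z ⟶ x} {b : z' ⟶ y} (β : X.Sq p m)
    (ha : X.left β = a) (hb : X.right β = b) :
    X.hsq β (X.hidSq b ≫ cg.unit) (by simp [hb]) ≫ slide cf cg α hf hg =
      ((X.runit p).hom ≫ (X.lunit p).inv) ≫
        X.hsq (X.hidSq a ≫ cf.unit) (β ≫ α) (by simp [ha, hf]) := by
  have hsq_factor : X.hsq β (X.hidSq b ≫ cg.unit) (by simp [hb]) =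
      X.hsq β (X.hidSq b) (by simp [hb]) ≫ X.hsq (X.one m) cg.unit (by simp) := by
    rw [hsq_hsq]
    exact hsq_congr _ (Category.comp_id _).symm rfl
  rw [hsq_factor, Category.assoc, unit_slide, ← Category.assoc,
    OplaxProtrans.idSq_naturality β ha hb, Category.assoc, hsq_hsq]

lemma slide_counit :
    X.hsq α cg.counit (by simp [hg]) ≫ (X.runit n).hom ≫ (X.lunit n).inv =
      slide cf cg α hf hg ≫ X.hsq cf.counit (X.one n) (by simp) := by
  unfold slide
  simp only [Category.assoc]
  rw [← Category.assoc, lunit_inv_naturality, hsq_hsq, hsq_hsq]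
  refine congrArg (_ ≫ ·) (hsq_congr _ ?_ (congrArg (_ ≫ ·) (Category.comp_id _).symm))
  rw [Category.id_comp, cf.unit_counit, left_comp, left_hsq, left_runit, hf, Category.comp_id]

lemma slide_naturality {x₁ y₁ x₁' y₁' : X.Obj} {m₁ : X.Pro x₁ y₁} {n₁ : X.Pro x₁' y₁'}
    {f₁ : x₁ ⟶ x₁'} {g₁ : y₁ ⟶ y₁'} (cf₁ : Companion f₁) (cg₁ : Companion g₁)
    (α₁ : X.Sq m₁ n₁) (hf₁ : X.left α₁ = f₁) (hg₁ : X.right α₁ = g₁) (μ : X.Sq m m₁)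
    (ν : X.Sq n n₁) (h : μ ≫ α₁ = α ≫ ν) (φ : X.Sq cf.pro cf₁.pro) (ψ : X.Sq cg.pro cg₁.pro)
    (hφ : X.right φ = X.left ν) (hψ : X.right μ = X.left ψ) (hψν : X.right ψ = X.right ν)
    (eφ : cf.unit ≫ φ = X.hidSq (X.left μ) ≫ cf₁.unit)
    (eψ : cg.unit ≫ ψ = X.hidSq (X.right μ) ≫ cg₁.unit) :
    X.hsq μ ψ hψ ≫ slide cf₁ cg₁ α₁ hf₁ hg₁ = slide cf cg α hf hg ≫ X.hsq φ ν hφ := by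
  refine cg.hcomp_hom_ext (by simp [hψν]) ?_
  rw [← Category.assoc, ← Category.assoc, unit_slide, hsq_hsq, Category.assoc, hsq_hsq,
    hsq_congr _ (Category.id_comp _) eψ, hsq_unit_slide _ _ _ _ _ _ rfl rfl,
    hsq_congr _ eφ h.symm]

lemma slide_naturality_of_globular {m₁ : X.Pro x y} {n₁ : X.Pro x' y'} (α₁ : X.Sq m₁ n₁)
    (hf₁ : X.left α₁ = f) (hg₁ : X.right α₁ = g) (μ : X.Sq m m₁) (ν : X.Sq n n₁)
    (h : μ ≫ α₁ = α ≫ ν) (ha : X.left μ = 𝟙 x) (hb : X.right μ = 𝟙 y) (ha' : X.left ν = 𝟙 x')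
    (hb' : X.right ν = 𝟙 y') :
    X.hsq μ (X.one cg.pro) (by simp [hb]) ≫ slide cf cg α₁ hf₁ hg₁ =
      slide cf cg α hf hg ≫ X.hsq (X.one cf.pro) ν (by simp [ha']) :=
  slide_naturality cf cg α hf hg cf cg α₁ hf₁ hg₁ μ ν h _ _ _ _ (by simp [hb']) (by simp [ha])
    (by simp [hb])

variable {α} in
lemma IsCommuter.isIso_slide (h : IsCommuter α) : IsIso (slide cf cg α hf hg) := by
  subst hf hg
  obtain ⟨cf', cg', h⟩ := h
  have hφ := Companion.IsComparison.of_comparison cf cf' rfl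
  have hψ := Companion.IsComparison.of_comparison cg cg' rfl
  have change_companions := slide_naturality cf cg α rfl rfl cf' cg' α rfl rfl (X.one m) (X.one n)
    (by simp) (cf.comparison cf' rfl) (cg.comparison cg' rfl) (by simp [hφ.right])
    (by simp [hψ.left]) (by simp [hψ.right]) (by simp [hφ.unit]) (by simp [hψ.unit])
  have := hφ.isIso
  have := hψ.isIso
  have := isIso_hsq (X.one m) (cg.comparison cg' rfl) (by simp [hψ.left])
  have := isIso_hsq (cf.comparison cf' rfl) (X.one n) (by simp [hφ.right])
  exact IsIso.of_isIso_fac_right change_companions.symm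

end

lemma runit_lunit_inv_hcomp {x y z : X.Obj} (m : X.Pro x y) (n : X.Pro y z) :
    (X.runit (X.hcomp m n)).hom ≫ (X.lunit (X.hcomp m n)).inv =
      (X.assoc m n (X.hid z)).hom ≫
        X.hsq (X.one m) ((X.runit n).hom ≫ (X.lunit n).inv) (by simp) ≫
        (X.assoc m (X.hid y) n).inv ≫
        X.hsq ((X.runit m).hom ≫ (X.lunit m).inv) (X.one n) (by simp) ≫
        (X.assoc (X.hid x) m n).hom := by
  have coherence : ∀ {a b c : Hor X} (m : a ⟶ b) (n : b ⟶ c),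
      (Bicategory.rightUnitor (m ≫ n)).hom ≫ (Bicategory.leftUnitor (m ≫ n)).inv =
        (Bicategory.associator m n (𝟙 c)).hom ≫
          Bicategory.whiskerLeft m
            ((Bicategory.rightUnitor n).hom ≫ (Bicategory.leftUnitor n).inv) ≫
          (Bicategory.associator m (𝟙 b) n).inv ≫
          Bicategory.whiskerRight
            ((Bicategory.rightUnitor m).hom ≫ (Bicategory.leftUnitor m).inv) n ≫
          (Bicategory.associator (𝟙 a) m n).hom := by
    intro a b c m n
    bicategory
  exact congrArg Glob.sq (coherence (a := ⟨x⟩) (b := ⟨y⟩) (c := ⟨z⟩) m n)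

lemma slide_hcomp {x y z x' y' z' : X.Obj} {m : X.Pro x y} {n : X.Pro y z} {m' : X.Pro x' y'}
    {n' : X.Pro y' z'} {f : x ⟶ x'} {g : y ⟶ y'} {k : z ⟶ z'} (cf : Companion f)
    (cg : Companion g) (ck : Companion k) (α : X.Sq m m') (β : X.Sq n n') (hf : X.left α = f)
    (hg : X.right α = g) (hg' : X.left β = g) (hk : X.right β = k) :
    slide cf ck (X.hsq α β (hg.trans hg'.symm)) (by simp [hf]) (by simp [hk]) =
      (X.assoc m n ck.pro).hom ≫
        X.hsq (X.one m) (slide cg ck β hg' hk) (by simp) ≫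
        (X.assoc m cg.pro n').inv ≫
        X.hsq (slide cf cg α hf hg) (X.one n') (by simp) ≫
        (X.assoc cf.pro m' n').hom := by
  symm
  refine eq_slide cf ck _ _ _ _ (by simp) ?_
  have slide_right : X.hsq (X.one m) (X.hsq (X.one n) ck.unit (by simp)) (by simp) ≫
        X.hsq (X.one m) (slide cg ck β hg' hk) (by simp) =
      X.hsq (X.one m) ((X.runit n).hom ≫ (X.lunit n).inv) (by simp) ≫
        X.hsq (X.one m) (X.hsq cg.unit β (by simp [hg'])) (by simp) := by
    rw [hsq_hsq, hsq_congr _ (Category.comp_id _) (unit_slide cg ck β hg' hk),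
      hsq_comp_right _ _ _ (by simp) (by simp)]
  have slide_left : X.hsq (X.hsq (X.one m) cg.unit (by simp)) β (by simp [hg']) ≫
        X.hsq (slide cf cg α hf hg) (X.one n') (by simp) =
      X.hsq ((X.runit m).hom ≫ (X.lunit m).inv) (X.one n) (by simp) ≫
        X.hsq (X.hsq cf.unit α (by simp [hf])) β (by simp [hg, hg']) := by
    rw [hsq_hsq, hsq_congr _ (unit_slide cf cg α hf hg) (Category.comp_id _),
      hsq_comp_left _ _ _ (by simp) (by simp [hg, hg'])]
  rw [reassoc_of% hsq_one_comp_assoc_hom m n ck.unit ck.left_unit, reassoc_of% slide_right,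
    assoc_inv_naturality_assoc _ _ _ (by simp) (by simp [hg']), reassoc_of% slide_left,
    X.assoc_naturality _ _ _ (by simp [hf]) (by simp [hg, hg']), runit_lunit_inv_hcomp]
  simp only [Category.assoc]

lemma slide_hidSq {x y : X.Obj} {f : x ⟶ y} (c : Companion f) :
    slide c c (X.hidSq f) (by simp) (by simp) = (X.lunit c.pro).hom ≫ (X.runit c.pro).inv := by
  symm
  refine eq_slide c c _ _ _ _ (by simp) ?_
  have unit_naturality := lunit_naturality' c.unit c.left_unit
  rw [hsq_congr _ (X.hidSq_id x) rfl] at unit_naturality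
  rw [← Category.assoc, unit_naturality, Category.assoc, runit_inv_naturality, unitors_hid,
    Category.assoc, unitors_inv_hid]
  exact congrArg (_ ≫ _ ≫ ·) (hsq_congr _ rfl (by rw [c.right_unit]))

end Slides

section Protransformations

variable {D : DoubleCategory.{u₁, v₁, w₁, t₁}} {E : DoubleCategory.{u₂, v₂, w₂, t₂}}
  {F G : LaxDoubleFunctor D E}

open LaxDoubleFunctor.NatTrans

/-- The oplax protransformation formed by companions of the components of a natural
transformation `α`, with the slides of the component cells of `α` as comparison cells. -/
def LaxOpl.protransOfCompanions (α : F ⟶ G) (c : ∀ x : D.Obj, Companion (app α x)) :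
    OplaxProtrans F G where
  app x := (c x).pro
  sq {x y} f := (c x).map (c y) (naturality α f)
  left_sq _ := Companion.left_map _ _ _
  right_sq _ := Companion.right_map _ _ _
  nat {x y} m := slide (c x) (c y) (sq α m) (left_sq α m) (right_sq α m)
  left_nat _ := left_slide _ _ _ _ _
  right_nat _ := right_slide _ _ _ _ _
  sq_id x := (c x).hom_ext_unit (by simp) (by simp [Companion.unit_map])
  sq_comp {x y z} f g := (c x).hom_ext_unit (by simp) (by
    rw [Companion.unit_map, ← Category.assoc, Companion.unit_map, Category.assoc,
      Companion.unit_map, F.map_comp, hidSq_comp, Category.assoc])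
  naturality γ := slide_naturality _ _ _ _ _ _ _ _ _ _ _ _ (sq_naturality α γ) _ _ _ _ (by simp)
    (by rw [Companion.unit_map, F.left_sq]) (by rw [Companion.unit_map, F.right_sq])
  nat_hcomp {x y z} m n := by
    rw [slide_naturality_of_globular (c x) (c z) _ (by simp) (by simp) _ (by simp) (by simp)
        (F.lax m n) (G.lax m n) (sq_hcomp α m n) (by simp) (by simp) (by simp) (by simp),
      slide_hcomp (c x) (c y) (c z) _ _ (by simp) (by simp) (by simp) (by simp)]
    simp only [Category.assoc]
  nat_hid x := by
    rw [slide_naturality_of_globular (c x) (c x) _ (by simp) (by simp) _ (by simp) (by simp)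
        (F.unit x) (G.unit x) (sq_hid α x) (by simp) (by simp) (by simp) (by simp),
      slide_hidSq, Category.assoc]

/-- The companion of a natural transformation in `LaxOpl D E` given by companions of its
components. -/
def LaxOpl.companion (α : F ⟶ G) (c : ∀ x : D.Obj, Companion (app α x)) :
    Companion (X := LaxOpl D E) (x := F) (y := G) α where
  pro := LaxOpl.protransOfCompanions α c
  unit :=
    { left := 𝟙 F
      right := α
      app x := (c x).unit
      left_app x := (c x).left_unit
      right_app x := (c x).right_unit
      internal {x y} f := (c x).unit_map (c y) (naturality α f)
      external m := unit_slide (c _) (c _) _ (left_sq α m) (right_sq α m) }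
  counit :=
    { left := α
      right := 𝟙 G
      app x := (c x).counit
      left_app x := (c x).left_counit
      right_app x := (c x).right_counit
      internal {x y} f := ((c x).map_counit (c y) (naturality α f)).symm
      external m := slide_counit (c _) (c _) _ (left_sq α m) (right_sq α m) }
  left_unit := rfl
  right_unit := rfl
  left_counit := rfl
  right_counit := rfl
  unit_counit := Modification.ext (Category.id_comp α) (Category.comp_id α)
    (funext fun x => (c x).unit_counit)
  hsq_unit_counit := Modification.ext
    ((Category.id_comp (𝟙 F ≫ 𝟙 F)).trans (Category.id_comp (𝟙 F)))
    ((Category.id_comp (𝟙 G ≫ 𝟙 G)).trans (Category.id_comp (𝟙 G)))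
    (funext fun x => (c x).hsq_unit_counit)

/-- A companion in `LaxOpl D E` of a natural transformation whose components have companions. -/
noncomputable def HasCompanionComponents.companion {α : F ⟶ G} (h : HasCompanionComponents α) :
    Companion (X := LaxOpl D E) (x := F) (y := G) α :=
  LaxOpl.companion α fun x => (h x).some

lemma HasCommuterComponents.isPseudo_companion {α : F ⟶ G} (h : HasCompanionComponents α)
    (h' : HasCommuterComponents α) :
    OplaxProtrans.IsPseudo (show OplaxProtrans F G from h.companion.pro) :=
  fun _ _ m => (h' m).isIso_slide _ _ (left_sq α m) (right_sq α m)

end Protransformations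

section RestrictPro

variable {X : DoubleCategory.{u, v, w, t}} {K : ∀ ⦃x y : X.Obj⦄, X.Pro x y → Prop}
  (hK : ∀ x, K (X.hid x))
  (hK' : ∀ ⦃x y z⦄ (m : X.Pro x y) (n : X.Pro y z), K m → K n → K (X.hcomp m n))

/-- A companion whose proarrow satisfies `K`, as a companion in the double category of proarrows
satisfying `K`. -/
def Companion.restrictPro {x y : X.Obj} {f : x ⟶ y} (c : Companion f) (h : K c.pro) :
    Companion (X := X.restrictPro K hK hK') (x := x) (y := y) f where
  __ := c
  pro := ⟨c.pro, h⟩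

variable {Y : DoubleCategory.{u₁, v₁, w₁, t₁}}

/-- The factorization of a double functor through the double category of proarrows satisfying
`K`. -/
def DoubleFunctor.restrictPro (P : DoubleFunctor Y X)
    (h : ∀ ⦃x y : Y.Obj⦄ (m : Y.Pro x y), K (P.pro m)) :
    DoubleFunctor Y (X.restrictPro K hK hK') where
  __ := P
  pro m := ⟨P.pro m, h m⟩
  isIso_lax m n := ⟨(P.isIso_lax m n).out⟩
  isIso_unit x := ⟨(P.isIso_unit x).out⟩

end RestrictPro

section CompanionFunctors

variable (D : DoubleCategory.{u₁, v₁, w₁, t₁}) (E : DoubleCategory.{u₂, v₂, w₂, t₂})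

/-- The double functor from the transpose of `LaxComp D E` choosing companions in `LaxOpl D E`. -/
noncomputable def LaxComp.companionFunctor :
    DoubleFunctor (LaxComp D E).transpose.toDouble (LaxOpl D E) :=
  quintetFunctor (X := LaxOpl D E) _ _ fun _ _ α => HasCompanionComponents.companion α.2

/-- The double functor from the transpose of `LaxCC D E` choosing companions in `LaxPs D E`. -/
noncomputable def LaxCC.companionFunctor :
    DoubleFunctor (LaxCC D E).transpose.toDouble (LaxPs D E) :=
  (quintetFunctor (X := LaxOpl D E) _ _ fun _ _ α =>
      HasCompanionComponents.companion α.2.1).restrictPro _ _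
    fun _ _ α => HasCommuterComponents.isPseudo_companion α.2.1 α.2.2

end CompanionFunctors

end DoubleCategory

theorem mainTheorem8 (D : DoubleCategory.{u₁, v₁, w₁, t₁}) (E : DoubleCategory.{u₂, v₂, w₂, t₂}) :
    (∃ P : DoubleCategory.DoubleFunctor (DoubleCategory.LaxComp D E).transpose.toDouble
        (DoubleCategory.LaxOpl D E),
      P.toFunctor = DoubleCategory.LaxComp.idFunctor D E ∧
      ∀ {F G : DoubleCategory.LaxDoubleFunctor D E}
        (α : (DoubleCategory.LaxComp D E).transpose.toDouble.Pro F G),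
        ∃ c : DoubleCategory.Companion (X := DoubleCategory.LaxOpl D E) (x := F) (y := G) α.1,
          HEq (P.pro α) c.pro) ∧
    (∃ P : DoubleCategory.DoubleFunctor (DoubleCategory.LaxCC D E).transpose.toDouble
        (DoubleCategory.LaxPs D E),
      P.toFunctor = DoubleCategory.LaxCC.idFunctor D E ∧
      ∀ {F G : DoubleCategory.LaxDoubleFunctor D E}
        (α : (DoubleCategory.LaxCC D E).transpose.toDouble.Pro F G),
        ∃ c : DoubleCategory.Companion (X := DoubleCategory.LaxPs D E) (x := F) (y := G) α.1,
          HEq (P.pro α) c.pro) := by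
  constructor
  · exact ⟨DoubleCategory.LaxComp.companionFunctor D E, rfl, fun α =>
      ⟨DoubleCategory.HasCompanionComponents.companion α.2, HEq.rfl⟩⟩
  · refine ⟨DoubleCategory.LaxCC.companionFunctor D E, rfl, fun α => ?_⟩
    have isPseudo := DoubleCategory.HasCommuterComponents.isPseudo_companion α.2.1 α.2.2
    exact ⟨(DoubleCategory.HasCompanionComponents.companion α.2.1).restrictPro _ _ isPseudo,
      HEq.rfl⟩
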